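/- Let $\mathbb K$ be a field of characteristic zero, $U$ a $\mathbb K$-vector space of finite dimension $r\ge 1$ and $V=U^*$ its dual. Let $X=(x_1,\dots,x_N)$ be a finite sequence of vectors spanning $U$. For a subsequence $Y\subseteq X$ let $\operatorname{rank}(Y)=\dim\operatorname{span}(Y)$ and $\operatorname{clos}_X(Y)=\{x\in X:\operatorname{rank}(Y\cup x)=\operatorname{rank}(Y)\}$; $C\subseteq X$ is a flat if $\operatorname{clos}_X(C)=C$, a hyperplane is a flat of rank $r-1$, and $\mathcal L(X)$ is the set of flats, ordered by inclusion. An element $x\in X$ is a loop if $x=0$, and a coloop if $\operatorname{rank}(X\setminus x)=r-1$. Let $k\ge -1$ be an integer and $J\subseteq\mathcal L(X)$ a non-empty upper set with indicator function $\chi_J$. A maximal missing flat is a maximal element of $\mathcal L(X)\setminus J$. A vector $\eta\in V$ is a defining normal of the flat $\{x\in X:\eta(x)=0\}$; put $m(C)=|X\setminus C|$, and write $m(\eta)$ and $\chi_J(\eta)$ for the values of $m$ and $\chi_J$ at the flat defined by $\eta$. Let $D_\eta$ be the image of $\eta$ in $\operatorname{Sym}(V)$, and $p_u$ the image of $u\in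 U$ in $\operatorname{Sym}(U)$. For a function $E$ that assigns a defining normal to every flat, define the ideals of $\operatorname{Sym}(V)$ $$\mathcal I(X,k,J)=\operatorname{ideal}\{D_\eta^{\,m(\eta)+k+\chi_J(\eta)}:\eta\in V\setminus\{0\}\},$$ $$\mathcal I'(X,k,J,E)=\operatorname{ideal}\{D_{E(C)}^{\,m(C)+k+\chi_J(C)}: C \text{ a hyperplane or a maximal missing flat}\}.$$ $\operatorname{Sym}(V)$ acts on $\operatorname{Sym}(U)$ by differential operators, $v\in V$ acting as the derivation $D_v$ with $D_v(u)=v(u)$ for $u\in U$. The kernel of an ideal $\mathcal I\subseteq\operatorname{Sym}(V)$ is the set of all $f\in\operatorname{Sym}(U)$ such that the degree zero component of $q\cdot f$ is $0$ for all $q\in\mathcal I$. For $x\in X$ let $X\setminus x$ be the deletion (a sequence in $U$) and $J\setminus x=\{C\setminus x: C\in J,\ C=\operatorname{clos}_X(C\setminus x)\}$. Let $\pi_x:U\to U/x:=U/\operatorname{span}(x)$ be the projection. For $x\neq0$ let $X/x$ be the sequence of images of the elements of $X\setminus x$ in $U/x$, and $J/x=\{\overline{C\setminus x}: x\in C\in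 J\}$, where $\overline{Y}$ denotes the subsequence of $X/x$ with the same indices as $Y\subseteq X\setminus x$. (If $r=1$, then $U/x=0$ and the same definitions are used; an ideal generated by the empty set is $0$.) **Proposition.** (1) Suppose that $x\in X$ is neither a loop nor a coloop and, if $k=-1$, that $J$ contains all hyperplanes of $X$ or $J=\{X\}$. Then $$0\to\ker\mathcal I(X\setminus x,k,J\setminus x)(-1)\xrightarrow{\ \cdot p_x\ }\ker\mathcal I(X,k,J)\xrightarrow{\ \operatorname{Sym}(\pi_x)\ }\ker\mathcal I(X/x,k,J/x)\to0$$ is an exact sequence of graded vector spaces, where $(-1)$ denotes raising all degrees by one and $\operatorname{Sym}(\pi_x)$ is the algebra homomorphism with $p_u\mapsto p_{\pi_x(u)}$. (2) If $x\in X$ is a loop, then $\ker\mathcal I(X\setminus x,k,J\setminus x)=\ker\mathcal I(X,k,J)$. (3) If $k\in\{-1,0\}$, then (1), under the same hypotheses, and (2) also hold with $\mathcal I'(X,k,J,E)$, $\mathcal I'(X\setminus x,k,J\setminus x,E')$ and $\mathcal I'(X/x,k,J/x,E'')$ in place of the corresponding ideals $\mathcal I$, for every choice of the functions $E,E',E''$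 that assign defining normals to the flats of $X$, $X\setminus x$ and $X/x$, respectively. -/

import Mathlib

noncomputable section

namespace Zonotopal

open Module

variable (K : Type*) [Field K]

section SymmetricAlgebraTools

variable {U : Type*} [AddCommGroup U] [Module K U]

/-- The algebra homomorphism `Sym U → Sym U[ε]` with `u ↦ u + v(u) ε`, where `ε ^ 2 = 0`.
It is only used to construct the directional derivative. -/
def taylorHom (v : Dual K U) :
    SymmetricAlgebra K U →ₐ[K]
      TrivSqZeroExt (SymmetricAlgebra K U) (SymmetricAlgebra K U) :=
  SymmetricAlgebra.lift
    ((TrivSqZeroExt.inlAlgHom K (SymmetricAlgebra K U) (SymmetricAlgebra K U)).toLinearMap ∘ₗ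
        SymmetricAlgebra.ι K U +
      (TrivSqZeroExt.inrHom (SymmetricAlgebra K U) (SymmetricAlgebra K U)).restrictScalars K ∘ₗ
        (Algebra.linearMap K (SymmetricAlgebra K U)) ∘ₗ v)

theorem taylorHom_ι (v : Dual K U) (u : U) :
    taylorHom K v (SymmetricAlgebra.ι K U u) =
      TrivSqZeroExt.inl (SymmetricAlgebra.ι K U u) +
        TrivSqZeroExt.inr (algebraMap K (SymmetricAlgebra K U) (v u)) := by
  simp [taylorHom]

theorem fst_taylorHom (v : Dual K U) (f : SymmetricAlgebra K U) :
    (taylorHom K v f).fst = f := by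
  have h : (TrivSqZeroExt.fstHom K (SymmetricAlgebra K U) (SymmetricAlgebra K U)).comp
      (taylorHom K v) = AlgHom.id K _ := by
    apply SymmetricAlgebra.algHom_ext
    ext u
    simp [taylorHom_ι]
  exact congrArg (fun F => F f) h

/-- The directional derivative `D_v : Sym U → Sym U` for `v ∈ V = U*`: the unique derivation with
`D_v u = v u` for all `u ∈ U`. -/
def dirDeriv (v : Dual K U) :
    Derivation K (SymmetricAlgebra K U) (SymmetricAlgebra K U) :=
  Derivation.mk'
    ((TrivSqZeroExt.sndHom (SymmetricAlgebra K U) (SymmetricAlgebra K U)).restrictScalars K ∘ₗ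
      (taylorHom K v).toLinearMap)
    (by
      intro a b
      simp [fst_taylorHom, mul_comm])

theorem dirDeriv_ι (v : Dual K U) (u : U) :
    dirDeriv K v (SymmetricAlgebra.ι K U u) = algebraMap K (SymmetricAlgebra K U) (v u) := by
  simp [dirDeriv, taylorHom_ι, Algebra.algebraMap_eq_smul_one]

theorem derivation_ext {D E : Derivation K (SymmetricAlgebra K U) (SymmetricAlgebra K U)}
    (h : ∀ u, D (SymmetricAlgebra.ι K U u) = E (SymmetricAlgebra.ι K U u)) : D = E := by
  ext f
  induction f using SymmetricAlgebra.induction with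
  | algebraMap r => simp
  | ι u => exact h u
  | mul a b ha hb => simp [Derivation.leibniz, ha, hb]
  | add a b ha hb => simp [ha, hb]

/-- `v ↦ D_v` as a linear map into the endomorphisms of the vector space `Sym U`. -/
def dirDerivEnd : Dual K U →ₗ[K] End K (SymmetricAlgebra K U) where
  toFun v := (dirDeriv K v).toLinearMap
  map_add' v w := by
    have h : dirDeriv K (v + w) = dirDeriv K v + dirDeriv K w :=
      derivation_ext K fun u => by simp [dirDeriv_ι]
    rw [h]; rfl
  map_smul' c v := by
    have h : dirDeriv K (c • v) = c • dirDeriv K v :=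
      derivation_ext K fun u => by simp [dirDeriv_ι, Algebra.smul_def]
    rw [h]; rfl

theorem dirDerivEnd_comm (v w : Dual K U) :
    dirDerivEnd K v * dirDerivEnd K w = dirDerivEnd K w * dirDerivEnd K v := by
  have h : ⁅dirDeriv K v, dirDeriv K w⁆ = 0 :=
    derivation_ext K fun u => by simp [Derivation.commutator_apply, dirDeriv_ι]
  ext f
  have h2 := congrArg (fun D => D f) h
  simp only [Derivation.commutator_apply, Derivation.zero_apply, sub_eq_zero] at h2
  exact h2

/-- The identification of `Sym V`, `V = U*`, with the ring of differential operators on `Sym U`: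
`v₁ ⋯ vₛ` acts as `D_{v₁} ∘ ⋯ ∘ D_{vₛ}`. -/
def diffOp : SymmetricAlgebra K (Dual K U) →ₐ[K] End K (SymmetricAlgebra K U) :=
  RingCon.liftₐEquiv (TensorAlgebra.symRingCon K (Dual K U))
    ⟨TensorAlgebra.lift K (dirDerivEnd K), RingCon.ringConGen_le.2 (by
      intro x y h
      induction h with
      | mul_comm v w =>
        rw [RingCon.ker_apply]
        simp [dirDerivEnd_comm K v w])⟩

theorem diffOp_ι (v : Dual K U) :
    diffOp K (SymmetricAlgebra.ι K (Dual K U) v) = dirDerivEnd K v := by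
  have h : (TensorAlgebra.lift K (dirDerivEnd K)) (TensorAlgebra.ι K v) = dirDerivEnd K v :=
    TensorAlgebra.lift_ι_apply _ _
  exact h

/-- The pairing `Sym U × Sym V → K`: the degree zero component of `q · f`. -/
def pairing (f : SymmetricAlgebra K U) (q : SymmetricAlgebra K (Dual K U)) : K :=
  SymmetricAlgebra.algebraMapInv (diffOp K q f)

/-- The kernel (inverse system) of an ideal `I ⊆ Sym V`, a subspace of `Sym U`. -/
def ker (I : Ideal (SymmetricAlgebra K (Dual K U))) : Submodule K (SymmetricAlgebra K U) where
  carrier := {f | ∀ q ∈ I, pairing K f q = 0}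
  add_mem' := by
    intro f g hf hg q hq
    have h1 := hf q hq
    have h2 := hg q hq
    simp only [pairing] at h1 h2 ⊢
    rw [map_add, map_add, h1, h2, add_zero]
  zero_mem' := by
    intro q _
    simp [pairing]
  smul_mem' := by
    intro c f hf q hq
    have h1 := hf q hq
    simp only [pairing] at h1 ⊢
    rw [map_smul, map_smul, h1, smul_zero]

/-- The homogeneous component of degree `n` of `Sym M`: the span of all products of `n` elements
of `M`. -/
def symDegree (M : Type*) [AddCommGroup M] [Module K M] (n : ℕ) :
    Submodule K (SymmetricAlgebra K M) :=
  LinearMap.range (SymmetricAlgebra.ι K M) ^ n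

/-- `W ⊆ Sym M` is a graded vector space with respect to the grading of `Sym M`: it is the internal
direct sum of the subspaces `W ∩ Symⁿ M`. -/
def IsGraded {M : Type*} [AddCommGroup M] [Module K M]
    (W : Submodule K (SymmetricAlgebra K M)) : Prop :=
  DirectSum.IsInternal fun n : ℕ => (symDegree K M n).comap W.subtype

/-- The algebra homomorphism `Sym f : Sym M → Sym M'` induced by a linear map `f`. -/
def symMap {M M' : Type*} [AddCommGroup M] [Module K M] [AddCommGroup M'] [Module K M']
    (f : M →ₗ[K] M') : SymmetricAlgebra K M →ₐ[K] SymmetricAlgebra K M' :=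
  SymmetricAlgebra.lift (SymmetricAlgebra.ι K M' ∘ₗ f)

/-- `0 → A(-1) → B → C → 0` is an exact sequence of graded vector spaces, where `A, B ⊆ Sym M` and
`C ⊆ Sym M'` are graded by degree, `A(-1)` is `A` with all degrees raised by one, and the two maps
are the restrictions of `φ` and `ψ`. -/
structure IsGradedShortExact {M M' : Type*} [AddCommGroup M] [Module K M]
    [AddCommGroup M'] [Module K M']
    (φ : SymmetricAlgebra K M →ₗ[K] SymmetricAlgebra K M)
    (ψ : SymmetricAlgebra K M →ₗ[K] SymmetricAlgebra K M')
    (A B : Submodule K (SymmetricAlgebra K M)) (C : Submodule K (SymmetricAlgebra K M')) :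
    Prop where
  graded_left : IsGraded K A
  graded_middle : IsGraded K B
  graded_right : IsGraded K C
  mapsTo_left : ∀ f ∈ A, φ f ∈ B
  mapsTo_right : ∀ g ∈ B, ψ g ∈ C
  degree_left : ∀ n, ∀ f ∈ A, f ∈ symDegree K M n → φ f ∈ symDegree K M (n + 1)
  degree_right : ∀ n, ∀ g ∈ B, g ∈ symDegree K M n → ψ g ∈ symDegree K M' n
  injective : ∀ f ∈ A, φ f = 0 → f = 0
  exact_middle : ∀ g ∈ B, ψ g = 0 ↔ ∃ f ∈ A, φ f = g
  surjective : ∀ h ∈ C, ∃ g ∈ B, ψ g = h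

end SymmetricAlgebraTools

section Matroids

variable {U : Type*} [AddCommGroup U] [Module K U] {ι : Type*}

/-! A finite sequence in `U` is a family `X : ι → U` on a finite index type, and a subsequence of
`X` is given by its set of indices. -/

/-- The rank of the subsequence indexed by `Y`. -/
def rank (X : ι → U) (Y : Set ι) : ℕ := finrank K (Submodule.span K (X '' Y))

/-- The closure of `Y` in the matroid of `X`. -/
def clos (X : ι → U) (Y : Set ι) : Set ι := {i | rank K X (insert i Y) = rank K X Y}

/-- `C` is a flat of the matroid of `X`. -/
def IsFlat (X : ι → U) (C : Set ι) : Prop := clos K X C = C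

/-- A hyperplane is a flat whose rank is `dim U - 1` (for `X` spanning `U`). -/
def IsHyperplane (X : ι → U) (H : Set ι) : Prop := IsFlat K X H ∧ rank K X H + 1 = finrank K U

/-- `i` is a coloop: deleting it lowers the rank to `dim U - 1` (for `X` spanning `U`). -/
def IsColoop (X : ι → U) (i : ι) : Prop := rank K X {i}ᶜ + 1 = finrank K U

/-- `J` is a non-empty upper set in the lattice of flats of `X`. -/
structure IsUpperSetOfFlats (X : ι → U) (J : Set (Set ι)) : Prop where
  isFlat : ∀ C ∈ J, IsFlat K X C
  nonempty : J.Nonempty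
  upward : ∀ C ∈ J, ∀ C', IsFlat K X C' → C ⊆ C' → C' ∈ J

/-- `C` is maximal among the flats that are not in `J`. -/
def IsMaximalMissingFlat (X : ι → U) (J : Set (Set ι)) (C : Set ι) : Prop :=
  Maximal (fun C => IsFlat K X C ∧ C ∉ J) C

/-- The flat defined by `η ∈ V = U*`. -/
def flatOf (X : ι → U) (η : Dual K U) : Set ι := {i | η (X i) = 0}

/-- `E` assigns a defining normal to every flat. (Its values off the flats are irrelevant.) -/
def IsNormalSelector (X : ι → U) (E : Set ι → Dual K U) : Prop :=
  ∀ C, IsFlat K X C → flatOf K X (E C) = C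

open Classical in
/-- The exponent `m(C) + k + χ_J(C)`, where `m(C)` is the number of elements outside `C`. If `X` is
spanning, `k ≥ -1` and `C` is a proper flat, this integer is non-negative. -/
def exponent (k : ℤ) (J : Set (Set ι)) (C : Set ι) : ℕ :=
  ((Cᶜ.ncard : ℤ) + k + (if C ∈ J then 1 else 0)).toNat

/-- The hierarchical zonotopal power ideal `I(X, k, J) ⊆ Sym V`. -/
def hierIdeal (X : ι → U) (k : ℤ) (J : Set (Set ι)) : Ideal (SymmetricAlgebra K (Dual K U)) :=
  Ideal.span {g | ∃ η : Dual K U, η ≠ 0 ∧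
    g = SymmetricAlgebra.ι K (Dual K U) η ^ exponent k J (flatOf K X η)}

/-- The power ideal `I'(X, k, J, E) ⊆ Sym V`. -/
def hierIdeal' (X : ι → U) (k : ℤ) (J : Set (Set ι)) (E : Set ι → Dual K U) :
    Ideal (SymmetricAlgebra K (Dual K U)) :=
  Ideal.span {g | ∃ C : Set ι, (IsHyperplane K X C ∨ IsMaximalMissingFlat K X J C) ∧
    g = SymmetricAlgebra.ι K (Dual K U) (E C) ^ exponent k J C}

/-- The deletion `X ∖ x`, where `x = X i`. -/
def deletion (X : ι → U) (i : ι) : {j // j ≠ i} → U := fun j => X j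

/-- The contraction `X / x`, a family in `U / x`, where `x = X i`. -/
def contraction (X : ι → U) (i : ι) : {j // j ≠ i} → U ⧸ Submodule.span K {X i} :=
  fun j => (Submodule.span K {X i}).mkQ (X j)

/-- `J ∖ x = {C ∖ x : C ∈ J, C = clos (C ∖ x)}`. -/
def delUpper (X : ι → U) (J : Set (Set ι)) (i : ι) : Set (Set {j // j ≠ i}) :=
  {C' | ∃ C ∈ J, C = clos K X (C \ {i}) ∧ C' = Subtype.val ⁻¹' C}

/-- `J / x = {C ∖ x : x ∈ C ∈ J}`, with `C ∖ x` regarded as a subsequence of `X / x`. -/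
def contrUpper (J : Set (Set ι)) (i : ι) : Set (Set {j // j ≠ i}) :=
  {C' | ∃ C ∈ J, i ∈ C ∧ C' = Subtype.val ⁻¹' C}

end Matroids

end Zonotopal

end

/-! In characteristic zero an element of $\operatorname{Sym}(U)$ lies in the kernel of an ideal
exactly when every operator in the ideal kills it (`mem_ker_iff`), so it suffices to test
generators. Hence $\ker\mathcal I(X,k,J)$ is the space `powKer` of all $f$ with
$D_\eta^{e(\eta)}f=0$ for every $\eta\ne0$, where $e(\eta)=m(\eta)+k+\chi(\eta)$. The flats in $J$
are encoded by an upper set $S$ of subspaces of $U$. Deletion does not change $S$, and contraction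
pulls subspaces of $U/x$ back to $U$, so the three terms of the sequence are spaces of one kind and
induction on the vectors becomes possible.

The main tool is the pencil lemma (`pencil_eq_zero`): if powers of several members $\eta+t\theta$ of
a pencil kill $f$, then $(\eta+T\theta)^d$, as a polynomial in $T$ modulo the annihilator of $f$,
has many prescribed roots, and it vanishes once their total multiplicity exceeds its degree.

Left and middle exactness: the kernel of $\operatorname{Sym}(\pi_x)$ is $p_x\operatorname{Sym}(U)$,
and $p_xf$ in the middle term forces $f$ into the left one (`mem_powKer_of_ι_mul_mem`). If
$\eta(x)\ne0$, dividing by $p_x$ lowers the exponent by one; if $\eta(x)=0$, either $p_x$ commutes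
with $D_\eta$ and cancels, or $\eta$ is approximated by functionals with the same flat in
$X\setminus x$ that do not vanish at $x$.

Surjectivity for $k\ge0$: the kernel is spanned by products $f\prod_{y\in Y}p_y$ with $\deg
f<k+\chi(\operatorname{span}(X\setminus Y))$, and such products lift from $U/x$ directly. The
spanning statement itself is an induction on $|X|$ that combines these lifts with left exactness
(`powKer_le_prodSpace_aux`).

Surjectivity for $k=-1$: if $J$ contains all hyperplanes, the kernel is the one for $k=0$, $J=\{X\}$
(`powKer_neg_one_eq_of_hyperplanes`). If $J=\{X\}$, the exponent $m(\eta)-1$ is reached from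
$m(\eta)$ through exponents `semiExp` that drop by one only when $\eta$ does not vanish on a
subspace $W$. Starting at $W=0$, vectors $b\in X$ are adjoined to $W$ one at a time. At each step a
lift is corrected by terms $D_\theta^{m(\theta)-1}g\cdot\prod p_z$, one for each relevant
hyperplane, which map to $0$ over $U/x$ (`exists_mem_powKer_semiExp_sup`).

For $\mathcal I'$ with $k\in\{-1,0\}$, induction on $m(\eta)$ along pencils shows that the
conditions at hyperplanes and maximal missing flats imply all the others (`mem_powKer_neg_one_iff`,
`mem_powKer_zero_of`), so both ideals have the same kernel. -/

noncomputable section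

namespace Zonotopal

open Module

/-! ### The grading of a symmetric algebra. -/

section Tools

variable (K : Type*) [Field K] {M : Type*} [AddCommGroup M] [Module K M]

/-- The algebra homomorphism `Sym M → (Sym M)[t]` with `m ↦ m t`. -/
def gradHom : SymmetricAlgebra K M →ₐ[K] Polynomial (SymmetricAlgebra K M) :=
  SymmetricAlgebra.lift
    (((Polynomial.monomial 1 : SymmetricAlgebra K M →ₗ[SymmetricAlgebra K M] _).restrictScalars K) ∘ₗ
      SymmetricAlgebra.ι K M)

theorem gradHom_ι (m : M) : gradHom K (SymmetricAlgebra.ι K M m) =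
    Polynomial.monomial 1 (SymmetricAlgebra.ι K M m) := by
  simp [gradHom]

/-- The projection of `Sym M` to its homogeneous component of degree `n`. -/
def homComp (n : ℕ) : SymmetricAlgebra K M →ₗ[K] SymmetricAlgebra K M :=
  ((Polynomial.lcoeff (SymmetricAlgebra K M) n).restrictScalars K) ∘ₗ (gradHom K).toLinearMap

theorem homComp_apply (n : ℕ) (f : SymmetricAlgebra K M) :
    homComp K n f = (gradHom K f).coeff n := rfl

theorem ι_mul_mem_symDegree (m : M) {n : ℕ} {f : SymmetricAlgebra K M}
    (hf : f ∈ symDegree K M n) : SymmetricAlgebra.ι K M m * f ∈ symDegree K M (n + 1) := by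
  rw [symDegree, pow_succ']
  exact Submodule.mul_mem_mul ⟨m, rfl⟩ hf

@[elab_as_elim]
theorem symDegree_succ_induction {n : ℕ} {P : SymmetricAlgebra K M → Prop}
    (h : ∀ m, ∀ f ∈ symDegree K M n, P (SymmetricAlgebra.ι K M m * f))
    (hadd : ∀ f g, P f → P g → P (f + g)) {f : SymmetricAlgebra K M}
    (hf : f ∈ symDegree K M (n + 1)) : P f := by
  rw [symDegree, pow_succ'] at hf
  induction hf using Submodule.mul_induction_on' with
  | mem_mul_mem a ha b hb =>
    obtain ⟨m, rfl⟩ := ha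
    exact h m b hb
  | add a _ b _ h1 h2 => exact hadd a b h1 h2

theorem mem_symDegree_zero {f : SymmetricAlgebra K M} :
    f ∈ symDegree K M 0 ↔ ∃ c : K, algebraMap K _ c = f := by
  rw [symDegree, pow_zero, Submodule.mem_one]

theorem gradHom_of_mem {n : ℕ} {f : SymmetricAlgebra K M} (hf : f ∈ symDegree K M n) :
    gradHom K f = Polynomial.monomial n f := by
  induction n generalizing f with
  | zero =>
    obtain ⟨c, rfl⟩ := (mem_symDegree_zero K).1 hf
    rw [AlgHom.commutes]; rfl
  | succ n ih =>
    refine symDegree_succ_induction K ?_ ?_ hf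
    · intro m g hg
      rw [map_mul, ih hg, gradHom_ι, Polynomial.monomial_mul_monomial, add_comm]
    · intro a b h1 h2
      rw [map_add, h1, h2, map_add]

theorem homComp_mem (n : ℕ) (f : SymmetricAlgebra K M) : homComp K n f ∈ symDegree K M n := by
  rw [homComp_apply]
  induction f using SymmetricAlgebra.induction generalizing n with
  | algebraMap r =>
    have h : gradHom K (algebraMap K (SymmetricAlgebra K M) r) =
        Polynomial.monomial 0 (algebraMap K (SymmetricAlgebra K M) r) :=
      gradHom_of_mem K ((mem_symDegree_zero K).2 ⟨r, rfl⟩)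
    rw [h, Polynomial.coeff_monomial]
    split_ifs with h0
    · subst h0; exact (mem_symDegree_zero K).2 ⟨r, rfl⟩
    · exact zero_mem _
  | ι m =>
    rw [gradHom_ι, Polynomial.coeff_monomial]
    split_ifs with h0
    · subst h0; rw [symDegree, pow_one]; exact ⟨m, rfl⟩
    · exact zero_mem _
  | mul a b ha hb =>
    rw [map_mul, Polynomial.coeff_mul]
    refine Submodule.sum_mem _ fun p hp => ?_
    rw [← Finset.HasAntidiagonal.mem_antidiagonal.1 hp, symDegree, pow_add]
    exact Submodule.mul_mem_mul (ha _) (hb _)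
  | add a b ha hb =>
    rw [map_add, Polynomial.coeff_add]
    exact add_mem (ha n) (hb n)

theorem homComp_of_mem {n : ℕ} {f : SymmetricAlgebra K M} (hf : f ∈ symDegree K M n) (j : ℕ) :
    homComp K j f = if n = j then f else 0 := by
  rw [homComp_apply, gradHom_of_mem K hf, Polynomial.coeff_monomial]

theorem sum_homComp (f : SymmetricAlgebra K M) :
    ∑ n ∈ Finset.range ((gradHom K f).natDegree + 1), homComp K n f = f := by
  have h : ((Polynomial.aeval (1 : SymmetricAlgebra K M)).restrictScalars K).comp (gradHom K) =
      AlgHom.id K _ := by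
    apply SymmetricAlgebra.algHom_ext
    ext m
    simp [gradHom_ι]
  have h1 := congrArg (fun F => F f) h
  simp only [AlgHom.comp_apply, AlgHom.restrictScalars_apply, Polynomial.aeval_def,
    Polynomial.eval₂_eq_sum_range, AlgHom.id_apply] at h1
  simpa [homComp_apply] using h1

theorem eq_zero_of_homComp {f : SymmetricAlgebra K M} (h : ∀ n, homComp K n f = 0) : f = 0 := by
  rw [← sum_homComp K f]
  exact Finset.sum_eq_zero fun n _ => h n

@[elab_as_elim]
theorem homogeneous_induction {P : SymmetricAlgebra K M → Prop}
    (h : ∀ n, ∀ f ∈ symDegree K M n, P f) (h0 : P 0)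
    (hadd : ∀ f g, P f → P g → P (f + g)) (f : SymmetricAlgebra K M) : P f := by
  rw [← sum_homComp K f]
  exact Finset.sum_induction _ P hadd h0 fun n _ => h n _ (homComp_mem K n f)

theorem homComp_zero_apply (f : SymmetricAlgebra K M) :
    homComp K 0 f = algebraMap K (SymmetricAlgebra K M) (SymmetricAlgebra.algebraMapInv f) := by
  have h : ((Polynomial.aeval (0 : SymmetricAlgebra K M)).restrictScalars K).comp (gradHom K) =
      (Algebra.ofId K (SymmetricAlgebra K M)).comp
        (SymmetricAlgebra.algebraMapInv (R := K) (M := M)) := by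
    apply SymmetricAlgebra.algHom_ext
    ext m
    simp [gradHom_ι, SymmetricAlgebra.algebraMapInv_ι]
  have h1 := congrArg (fun F => F f) h
  simp only [AlgHom.comp_apply, AlgHom.restrictScalars_apply, Polynomial.aeval_def] at h1
  rw [homComp_apply]
  simpa using h1

/-- Projecting to degree $n$ reads off the $n$-th summand, which gives independence; stability under
the projections supplies the decomposition. -/
theorem isGraded_of_homComp_mem {W : Submodule K (SymmetricAlgebra K M)}
    (h : ∀ f ∈ W, ∀ n, homComp K n f ∈ W) : IsGraded K W := by
  classical
  have key : ∀ (x : DirectSum ℕ fun n => ((symDegree K M n).comap W.subtype)) (n : ℕ),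
      homComp K n ((DirectSum.coeAddMonoidHom
        (fun n => (symDegree K M n).comap W.subtype) x : W) : SymmetricAlgebra K M) =
        ((x n : W) : SymmetricAlgebra K M) := by
    intro x n
    induction x using DirectSum.induction_on with
    | zero => simp
    | of i y =>
      rw [DirectSum.coeAddMonoidHom_of, homComp_of_mem K (n := i) (f := ((y : W) : SymmetricAlgebra K M)) y.2]
      split_ifs with hi
      · subst hi; simp
      · rw [DirectSum.of_eq_of_ne _ _ _ (Ne.symm hi)]; rfl
    | add x y hx hy =>
      simp only [map_add, Submodule.coe_add, hx, hy, DirectSum.add_apply]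
  refine ⟨?_, ?_⟩
  · intro x y hxy
    refine DFinsupp.ext fun n => Subtype.ext (Subtype.ext ?_)
    rw [← key x n, ← key y n, hxy]
  · intro f
    refine ⟨∑ n ∈ Finset.range ((gradHom K f.1).natDegree + 1),
      DirectSum.of (fun n => ((symDegree K M n).comap W.subtype)) n
        ⟨⟨homComp K n f.1, h _ f.2 n⟩, homComp_mem K n f.1⟩, ?_⟩
    rw [map_sum]
    simp only [DirectSum.coeAddMonoidHom_of]
    apply Subtype.ext
    rw [AddSubmonoidClass.coe_finsetSum]
    exact sum_homComp K f.1

end Tools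

/-! ### Powers of directional derivatives, and kernels of ideals. -/

section Derivatives

variable (K : Type*) [Field K] {U : Type*} [AddCommGroup U] [Module K U]

theorem dirDerivEnd_algebraMap (η : Dual K U) (c : K) :
    dirDerivEnd K η (algebraMap K _ c) = 0 := (dirDeriv K η).map_algebraMap c

theorem dirDerivEnd_mul (η : Dual K U) (f g : SymmetricAlgebra K U) :
    dirDerivEnd K η (f * g) = f * dirDerivEnd K η g + dirDerivEnd K η f * g := by
  have := (dirDeriv K η).leibniz f g
  simp only [smul_eq_mul] at this
  rw [mul_comm (dirDerivEnd K η f) g]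
  exact this

theorem dirDerivEnd_ι (η : Dual K U) (u : U) :
    dirDerivEnd K η (SymmetricAlgebra.ι K U u) = algebraMap K _ (η u) := dirDeriv_ι K η u

theorem dirDerivEnd_ι_mul (η : Dual K U) (u : U) (f : SymmetricAlgebra K U) :
    dirDerivEnd K η (SymmetricAlgebra.ι K U u * f) =
      SymmetricAlgebra.ι K U u * dirDerivEnd K η f + η u • f := by
  rw [dirDerivEnd_mul, dirDerivEnd_ι, Algebra.smul_def]

theorem pow_succ_apply {A : Type*} [AddCommGroup A] [Module K A] (D : End K A) (n : ℕ)
    (f : A) : (D ^ (n + 1)) f = D ((D ^ n) f) := by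
  rw [pow_succ']; rfl

theorem pow_succ_apply' {A : Type*} [AddCommGroup A] [Module K A] (D : End K A) (n : ℕ)
    (f : A) : (D ^ (n + 1)) f = (D ^ n) (D f) := by
  rw [pow_succ]; rfl

theorem pow_apply_eq_zero_of_le {A : Type*} [AddCommGroup A] [Module K A] {D : End K A} {m n : ℕ}
    {f : A} (h : (D ^ m) f = 0) (hmn : m ≤ n) : (D ^ n) f = 0 := by
  obtain ⟨c, rfl⟩ := Nat.exists_eq_add_of_le' hmn
  rw [pow_add, Module.End.mul_apply, h, map_zero]

theorem dirDerivEnd_pow_succ_ι_mul (η : Dual K U) (u : U) (n : ℕ) (f : SymmetricAlgebra K U) :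
    (dirDerivEnd K η ^ (n + 1)) (SymmetricAlgebra.ι K U u * f) =
      SymmetricAlgebra.ι K U u * (dirDerivEnd K η ^ (n + 1)) f +
        ((n + 1 : K) * η u) • (dirDerivEnd K η ^ n) f := by
  induction n with
  | zero => simp [dirDerivEnd_ι_mul]
  | succ n ih =>
    rw [pow_succ_apply, ih, map_add, dirDerivEnd_ι_mul, map_smul, ← pow_succ_apply,
      ← pow_succ_apply, add_assoc, ← add_smul]
    congr 2
    push_cast
    ring

theorem dirDerivEnd_mem_symDegree (η : Dual K U) (n : ℕ) {f : SymmetricAlgebra K U}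
    (hf : f ∈ symDegree K U (n + 1)) : dirDerivEnd K η f ∈ symDegree K U n := by
  induction n generalizing f with
  | zero =>
    refine symDegree_succ_induction K ?_ ?_ hf
    · intro m g hg
      obtain ⟨c, rfl⟩ := (mem_symDegree_zero K).1 hg
      rw [dirDerivEnd_ι_mul, dirDerivEnd_algebraMap, mul_zero, zero_add]
      exact Submodule.smul_mem _ _ hg
    · intro a b h1 h2
      rw [map_add]; exact add_mem h1 h2
  | succ n ih =>
    refine symDegree_succ_induction K ?_ ?_ hf
    · intro m g hg
      rw [dirDerivEnd_ι_mul]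
      exact add_mem (ι_mul_mem_symDegree K m (ih hg)) (Submodule.smul_mem _ _ hg)
    · intro a b h1 h2
      rw [map_add]; exact add_mem h1 h2

theorem homComp_dirDerivEnd (η : Dual K U) (n : ℕ) (f : SymmetricAlgebra K U) :
    homComp K n (dirDerivEnd K η f) = dirDerivEnd K η (homComp K (n + 1) f) := by
  refine homogeneous_induction K ?_ ?_ ?_ f
  · intro j g hg
    cases j with
    | zero =>
      obtain ⟨c, rfl⟩ := (mem_symDegree_zero K).1 hg
      rw [dirDerivEnd_algebraMap, homComp_of_mem K hg]
      simp
    | succ j =>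
      rw [homComp_of_mem K hg, homComp_of_mem K (dirDerivEnd_mem_symDegree K η j hg)]
      by_cases h : j = n
      · simp [h]
      · simp [h]
  · simp
  · intro a b h1 h2
    simp only [map_add, h1, h2]

theorem homComp_dirDerivEnd_pow (η : Dual K U) (n e : ℕ) (f : SymmetricAlgebra K U) :
    homComp K n ((dirDerivEnd K η ^ e) f) = (dirDerivEnd K η ^ e) (homComp K (n + e) f) := by
  induction e generalizing n with
  | zero => simp
  | succ e ih =>
    rw [pow_succ_apply, homComp_dirDerivEnd, ih, pow_succ_apply]
    congr 4
    omega

/-- Evaluation of an element of `Sym U`, a polynomial function on `U*`, at `η ∈ U*`. -/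
def evalAt (η : Dual K U) : SymmetricAlgebra K U →ₐ[K] K := SymmetricAlgebra.lift η

/-- This turns annihilation of a form into its vanishing at the point $\eta$, provided that $n!$ is
invertible. -/
theorem dirDerivEnd_pow_of_mem (η : Dual K U) {n : ℕ} {f : SymmetricAlgebra K U}
    (hf : f ∈ symDegree K U n) :
    (dirDerivEnd K η ^ n) f = algebraMap K _ (n.factorial * evalAt K η f) := by
  induction n generalizing f with
  | zero =>
    obtain ⟨c, rfl⟩ := (mem_symDegree_zero K).1 hf
    simp
  | succ n ih =>
    refine symDegree_succ_induction K ?_ ?_ hf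
    · intro m g hg
      rw [dirDerivEnd_pow_succ_ι_mul, pow_succ_apply, ih hg, dirDerivEnd_algebraMap, mul_zero,
        zero_add, Algebra.smul_def, ← map_mul, map_mul (evalAt K η)]
      have : evalAt K η (SymmetricAlgebra.ι K U m) = η m := by simp [evalAt]
      rw [this, Nat.factorial_succ]
      push_cast
      ring_nf
    · intro a b h1 h2
      rw [map_add, h1, h2, ← map_add, map_add (evalAt K η), mul_add]

theorem dirDerivEnd_pow_eq_zero_of_mem (η : Dual K U) {n e : ℕ} {f : SymmetricAlgebra K U}
    (hf : f ∈ symDegree K U n) (hne : n < e) : (dirDerivEnd K η ^ e) f = 0 := by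
  refine pow_apply_eq_zero_of_le K (m := n + 1) ?_ hne
  rw [pow_succ_apply, dirDerivEnd_pow_of_mem K η hf, dirDerivEnd_algebraMap]

theorem dirDerivEnd_pow_homComp_eq_zero {η : Dual K U} {e : ℕ} {f : SymmetricAlgebra K U}
    (h : (dirDerivEnd K η ^ e) f = 0) (n : ℕ) : (dirDerivEnd K η ^ e) (homComp K n f) = 0 := by
  by_cases hn : n < e
  · exact dirDerivEnd_pow_eq_zero_of_mem K η (homComp_mem K n f) hn
  · obtain ⟨c, rfl⟩ := Nat.exists_eq_add_of_le' (not_lt.1 hn)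
    rw [← homComp_dirDerivEnd_pow, h, map_zero]

theorem exists_dirDerivEnd_pow_eq_zero (η : Dual K U) (f : SymmetricAlgebra K U) :
    ∃ e, (dirDerivEnd K η ^ e) f = 0 := by
  refine homogeneous_induction K ?_ ⟨0, by simp⟩ ?_ f
  · intro j g hg
    exact ⟨j + 1, dirDerivEnd_pow_eq_zero_of_mem K η hg j.lt_succ_self⟩
  · intro a b h1 h2
    obtain ⟨m, hm⟩ := h1
    obtain ⟨n, hn⟩ := h2
    exact ⟨max m n, by rw [map_add, pow_apply_eq_zero_of_le K hm (le_max_left _ _),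
      pow_apply_eq_zero_of_le K hn (le_max_right _ _), add_zero]⟩

/-- By Leibniz, in each term of $D^{a+c}(fg)$ either $f$ is differentiated at least $a$ times or $g$
at least $c+1$ times. The induction peels off one derivative at a time. -/
theorem dirDerivEnd_pow_mul_eq_zero (η : Dual K U) {f g : SymmetricAlgebra K U} {a c : ℕ}
    (hf : (dirDerivEnd K η ^ a) f = 0) (hg : (dirDerivEnd K η ^ (c + 1)) g = 0) :
    (dirDerivEnd K η ^ (a + c)) (f * g) = 0 := by
  induction h : a + c generalizing a c f g with
  | zero =>
    obtain rfl : a = 0 := by omega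
    have : f = 0 := by simpa using hf
    simp [this]
  | succ n ih =>
    rcases a with _ | a
    · have : f = 0 := by simpa using hf
      simp [this]
    rw [pow_succ_apply', dirDerivEnd_mul, map_add]
    have h2 : (dirDerivEnd K η ^ n) (dirDerivEnd K η f * g) = 0 :=
      ih (a := a) (c := c) (by rwa [pow_succ_apply'] at hf) hg (by omega)
    rw [h2, add_zero]
    rcases c with _ | c
    · have : dirDerivEnd K η g = 0 := by simpa using hg
      simp [this]
    · exact ih (a := a + 1) (c := c) hf (by rwa [pow_succ_apply'] at hg) (by omega)

theorem dirDerivEnd_smul_pow (c : K) (η : Dual K U) (e : ℕ) :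
    dirDerivEnd K (c • η) ^ e = c ^ e • dirDerivEnd K η ^ e := by
  rw [map_smul, smul_pow]

theorem dirDerivEnd_pow_ι_mul_of_apply_eq_zero {η : Dual K U} {u : U} (h : η u = 0) (n : ℕ)
    (f : SymmetricAlgebra K U) :
    (dirDerivEnd K η ^ n) (SymmetricAlgebra.ι K U u * f) =
      SymmetricAlgebra.ι K U u * (dirDerivEnd K η ^ n) f := by
  rcases n with _ | n
  · simp
  · rw [dirDerivEnd_pow_succ_ι_mul, h, mul_zero, zero_smul, add_zero]

theorem dirDerivEnd_pow_prod_succ (η : Dual K U) (Y : Multiset U) :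
    (dirDerivEnd K η ^ (Y.card + 1)) (Y.map (SymmetricAlgebra.ι K U)).prod = 0 := by
  induction Y using Multiset.induction with
  | empty => simpa using dirDerivEnd_algebraMap K η 1
  | cons u Y ih =>
    rw [Multiset.map_cons, Multiset.prod_cons, Multiset.card_cons, dirDerivEnd_pow_succ_ι_mul, ih,
      pow_succ_apply, ih]
    simp

theorem dirDerivEnd_pow_prod (η : Dual K U) (Y : Multiset U) :
    (dirDerivEnd K η ^ Y.card) (Y.map (SymmetricAlgebra.ι K U)).prod =
      algebraMap K _ (Y.card.factorial * (Y.map η).prod) := by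
  induction Y using Multiset.induction with
  | empty => simp
  | cons u Y ih =>
    rw [Multiset.map_cons, Multiset.prod_cons, Multiset.card_cons, dirDerivEnd_pow_succ_ι_mul, ih,
      dirDerivEnd_pow_prod_succ, Multiset.map_cons, Multiset.prod_cons, Nat.factorial_succ,
      Algebra.smul_def, ← map_mul]
    push_cast
    ring_nf

open Classical in
theorem dirDerivEnd_pow_prod_eq_zero (η : Dual K U) (Y : Multiset U) :
    (dirDerivEnd K η ^ ((Y.filter fun z => η z ≠ 0).card + 1))
      (Y.map (SymmetricAlgebra.ι K U)).prod = 0 := by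
  induction Y using Multiset.induction with
  | empty => simpa using dirDerivEnd_algebraMap K η 1
  | cons u Y ih =>
    rw [Multiset.map_cons, Multiset.prod_cons]
    by_cases hu : η u = 0
    · rw [Multiset.filter_cons_of_neg _ (by simpa using hu),
        dirDerivEnd_pow_ι_mul_of_apply_eq_zero K hu, ih, mul_zero]
    · rw [Multiset.filter_cons_of_pos (p := fun z => η z ≠ 0) _ hu, Multiset.card_cons, dirDerivEnd_pow_succ_ι_mul, ih,
        pow_succ_apply, ih]
      simp

theorem dirDerivEnd_pow_mul_of_eq_zero {η : Dual K U} {f : SymmetricAlgebra K U}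
    (hf : dirDerivEnd K η f = 0) (n : ℕ) (g : SymmetricAlgebra K U) :
    (dirDerivEnd K η ^ n) (f * g) = f * (dirDerivEnd K η ^ n) g := by
  induction n with
  | zero => simp
  | succ n ih =>
    rw [pow_succ_apply, ih, dirDerivEnd_mul, hf, zero_mul, add_zero, pow_succ_apply]

theorem diffOp_ι_pow (η : Dual K U) (e : ℕ) :
    diffOp K (SymmetricAlgebra.ι K (Dual K U) η ^ e) = dirDerivEnd K η ^ e := by
  rw [map_pow, diffOp_ι]

/-- The ideal of differential operators that annihilate `f`. -/
def annIdeal (f : SymmetricAlgebra K U) : Ideal (SymmetricAlgebra K (Dual K U)) where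
  carrier := {q | diffOp K q f = 0}
  add_mem' := by
    intro a b ha hb
    simp only [Set.mem_ofPred_eq] at ha hb ⊢
    rw [map_add, LinearMap.add_apply, ha, hb, add_zero]
  zero_mem' := by simp
  smul_mem' := by
    intro c q hq
    simp only [Set.mem_ofPred_eq] at hq ⊢
    rw [smul_eq_mul, map_mul, Module.End.mul_apply, hq, map_zero]

theorem mem_annIdeal {f : SymmetricAlgebra K U} {q : SymmetricAlgebra K (Dual K U)} :
    q ∈ annIdeal K f ↔ diffOp K q f = 0 := Iff.rfl

theorem ι_pow_mem_annIdeal {f : SymmetricAlgebra K U} {η : Dual K U} {e : ℕ} :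
    SymmetricAlgebra.ι K (Dual K U) η ^ e ∈ annIdeal K f ↔ (dirDerivEnd K η ^ e) f = 0 := by
  rw [mem_annIdeal, diffOp_ι_pow]

variable [CharZero K]

/-- If $D^M f$ is the last non-zero derivative of $f$, then
$D^{M+1}(p_uf)=(M+1)\,\eta(u)\,D^Mf\ne0$, so multiplication by $p_u$ raises the nilpotency order by
one. -/
theorem dirDerivEnd_pow_pred_of_ι_mul {η : Dual K U} {u : U} (hu : η u ≠ 0) {e : ℕ}
    {f : SymmetricAlgebra K U}
    (h : (dirDerivEnd K η ^ e) (SymmetricAlgebra.ι K U u * f) = 0) :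
    (dirDerivEnd K η ^ (e - 1)) f = 0 := by
  classical
  have hex := exists_dirDerivEnd_pow_eq_zero K η f
  by_cases hN : Nat.find hex ≤ e - 1
  · exact pow_apply_eq_zero_of_le K (Nat.find_spec hex) hN
  exfalso
  obtain ⟨M, hM⟩ : ∃ M, Nat.find hex = M + 1 := Nat.exists_eq_succ_of_ne_zero (by omega)
  have h1 : (dirDerivEnd K η ^ (M + 1)) f = 0 := hM ▸ Nat.find_spec hex
  have h2 : (dirDerivEnd K η ^ M) f ≠ 0 := Nat.find_min hex (by omega)
  have h3 := dirDerivEnd_pow_succ_ι_mul K η u M f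
  rw [h1, mul_zero, zero_add, pow_apply_eq_zero_of_le K h (by omega), eq_comm, smul_eq_zero] at h3
  rcases h3 with h3 | h3
  · exact mul_ne_zero (by exact_mod_cast M.succ_ne_zero) hu h3
  · exact h2 h3

variable [FiniteDimensional K U]

theorem eq_zero_of_evalAt {f : SymmetricAlgebra K U} (h : ∀ η, evalAt K η f = 0) : f = 0 := by
  let b := Module.finBasis K U
  apply (SymmetricAlgebra.equivMvPolynomial b).injective
  rw [map_zero]
  apply MvPolynomial.funext
  intro x
  have hx : (MvPolynomial.aeval x).comp (SymmetricAlgebra.equivMvPolynomial b).toAlgHom =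
      evalAt K (b.constr K x) := by
    apply SymmetricAlgebra.algHom_ext
    apply b.ext
    intro i
    simp [evalAt]
  have h1 := congrArg (fun F => F f) hx
  simp only [AlgHom.comp_apply, h] at h1
  simpa [MvPolynomial.aeval_eq_eval] using h1

/-- The constant term of $D_\eta^nf$ is $n!\,f_n(\eta)$, so these constant terms determine every
homogeneous component as a polynomial function. -/
theorem eq_zero_of_algebraMapInv {f : SymmetricAlgebra K U}
    (h : ∀ (η : Dual K U) (n : ℕ),
      SymmetricAlgebra.algebraMapInv ((dirDerivEnd K η ^ n) f) = (0 : K)) : f = 0 := by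
  refine eq_zero_of_homComp K fun n => eq_zero_of_evalAt K fun η => ?_
  have h1 := homComp_zero_apply K ((dirDerivEnd K η ^ n) f)
  rw [h, homComp_dirDerivEnd_pow, zero_add, dirDerivEnd_pow_of_mem K η (homComp_mem K n f),
    map_zero, SymmetricAlgebra.algebraMap_eq_zero_iff] at h1
  exact (mul_eq_zero.1 h1).resolve_left (by exact_mod_cast n.factorial_ne_zero)

/-- With $q$ the ideal also contains $D_\eta^nq$ for all $\eta$ and $n$, so the constant terms of
all derivatives of $q\cdot f$ vanish, and therefore $q\cdot f=0$. -/
theorem mem_ker_iff {I : Ideal (SymmetricAlgebra K (Dual K U))} {f : SymmetricAlgebra K U} :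
    f ∈ ker K I ↔ I ≤ annIdeal K f := by
  constructor
  · intro hf q hq
    rw [mem_annIdeal]
    refine eq_zero_of_algebraMapInv K fun η n => ?_
    have := hf (SymmetricAlgebra.ι K (Dual K U) η ^ n * q) (I.mul_mem_left _ hq)
    rwa [pairing, map_mul, diffOp_ι_pow, Module.End.mul_apply] at this
  · intro h q hq
    have := h hq
    rw [mem_annIdeal] at this
    rw [pairing, this, map_zero]

end Derivatives

/-! ### Induced maps of symmetric algebras, and the kernel of contraction. -/

section Functoriality

variable (K : Type*) [Field K] {U : Type*} [AddCommGroup U] [Module K U]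
  {U' : Type*} [AddCommGroup U'] [Module K U']

theorem symMap_ι (p : U →ₗ[K] U') (u : U) :
    symMap K p (SymmetricAlgebra.ι K U u) = SymmetricAlgebra.ι K U' (p u) := by
  simp [symMap]

theorem symMap_dirDerivEnd (p : U →ₗ[K] U') (η : Dual K U') (f : SymmetricAlgebra K U) :
    symMap K p (dirDerivEnd K (η ∘ₗ p) f) = dirDerivEnd K η (symMap K p f) := by
  induction f using SymmetricAlgebra.induction with
  | algebraMap r => rw [dirDerivEnd_algebraMap, AlgHom.commutes, dirDerivEnd_algebraMap, map_zero]
  | ι u => rw [dirDerivEnd_ι, symMap_ι, dirDerivEnd_ι, AlgHom.commutes]; rfl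
  | mul a b ha hb => rw [dirDerivEnd_mul, map_add, map_mul, map_mul, ha, hb, map_mul,
      dirDerivEnd_mul]
  | add a b ha hb => simp only [map_add, ha, hb]

theorem symMap_dirDerivEnd_pow (p : U →ₗ[K] U') (η : Dual K U') (n : ℕ)
    (f : SymmetricAlgebra K U) :
    symMap K p ((dirDerivEnd K (η ∘ₗ p) ^ n) f) = (dirDerivEnd K η ^ n) (symMap K p f) := by
  induction n with
  | zero => simp
  | succ n ih => rw [pow_succ_apply, symMap_dirDerivEnd, ih, pow_succ_apply]

theorem symMap_mem_symDegree (p : U →ₗ[K] U') {n : ℕ} {f : SymmetricAlgebra K U}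
    (hf : f ∈ symDegree K U n) : symMap K p f ∈ symDegree K U' n := by
  induction n generalizing f with
  | zero =>
    obtain ⟨c, rfl⟩ := (mem_symDegree_zero K).1 hf
    rw [AlgHom.commutes]
    exact (mem_symDegree_zero K).2 ⟨c, rfl⟩
  | succ n ih =>
    refine symDegree_succ_induction K ?_ ?_ hf
    · intro m g hg
      rw [map_mul, symMap_ι]; exact ι_mul_mem_symDegree K _ (ih hg)
    · intro a b h1 h2
      rw [map_add]; exact add_mem h1 h2

theorem symMap_prod (p : U →ₗ[K] U') (Y : Multiset U) :
    symMap K p (Y.map (SymmetricAlgebra.ι K U)).prod =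
      ((Y.map p).map (SymmetricAlgebra.ι K U')).prod := by
  rw [map_multiset_prod, Multiset.map_map, Multiset.map_map]
  simp [symMap_ι]

theorem exists_symMap_section (x : U) :
    ∃ s : (U ⧸ Submodule.span K {x}) →ₗ[K] U, ∀ f,
      symMap K (Submodule.span K {x}).mkQ (symMap K s f) = f := by
  obtain ⟨s, hs⟩ := (Submodule.span K {x}).mkQ.exists_rightInverse_of_surjective
    (Submodule.range_mkQ _)
  refine ⟨s, fun f => ?_⟩
  have h : (symMap K (Submodule.span K {x}).mkQ).comp (symMap K s) = AlgHom.id K _ := by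
    apply SymmetricAlgebra.algHom_ext
    ext u
    have := LinearMap.congr_fun hs (Submodule.Quotient.mk u)
    simpa [symMap_ι] using congrArg (SymmetricAlgebra.ι K _) this
  exact congrArg (fun F => F f) h

/-- Modulo the ideal $(p_x)$ the identity factors through $\operatorname{Sym}(U/x)$ by means of a
linear section of the projection. -/
theorem symMap_mkQ_eq_zero_iff (x : U) (g : SymmetricAlgebra K U) :
    symMap K (Submodule.span K {x}).mkQ g = 0 ↔ ∃ f, SymmetricAlgebra.ι K U x * f = g := by
  have hx : (Submodule.span K {x}).mkQ x = 0 := by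
    simp
  constructor
  · intro hg
    obtain ⟨s, hs⟩ := (Submodule.span K {x}).mkQ.exists_rightInverse_of_surjective
      (Submodule.range_mkQ _)
    let I : Ideal (SymmetricAlgebra K U) := Ideal.span {SymmetricAlgebra.ι K U x}
    have h : (Ideal.Quotient.mkₐ K I) =
        (Ideal.Quotient.mkₐ K I).comp ((symMap K s).comp (symMap K (Submodule.span K {x}).mkQ)) := by
      apply SymmetricAlgebra.algHom_ext
      ext u
      change Ideal.Quotient.mk I _ = Ideal.Quotient.mk I (symMap K s (symMap K _ _))
      rw [symMap_ι, symMap_ι, Ideal.Quotient.eq, ← map_sub]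
      have h1 : (Submodule.span K {x}).mkQ (u - s ((Submodule.span K {x}).mkQ u)) = 0 := by
        have := LinearMap.congr_fun hs ((Submodule.span K {x}).mkQ u)
        rw [map_sub, sub_eq_zero]
        exact this.symm
      rw [← LinearMap.mem_ker, Submodule.ker_mkQ, Submodule.mem_span_singleton] at h1
      obtain ⟨c, hc⟩ := h1
      rw [← hc, map_smul]
      exact Submodule.smul_of_tower_mem _ c (Ideal.subset_span rfl)
    have h1 := congrArg (fun F => F g) h
    simp only [AlgHom.comp_apply, hg, map_zero, Ideal.Quotient.mkₐ_eq_mk] at h1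
    rw [Ideal.Quotient.eq_zero_iff_mem, Ideal.mem_span_singleton] at h1
    obtain ⟨f, hf⟩ := h1
    exact ⟨f, hf.symm⟩
  · rintro ⟨f, rfl⟩
    rw [map_mul, symMap_ι, hx, map_zero, zero_mul]

end Functoriality

/-! ### The pencil lemma. -/

section Pencils

variable (K : Type*) [Field K]

open Polynomial in
theorem pencil_eq_zero {A : Type*} [CommRing A] [Algebra K A] {η θ : A} {T : Finset K}
    {a : K → ℕ} {d b : ℕ} (hT : ∀ t ∈ T, (η + t • θ) ^ a t = 0) (hθ : b ≤ d → θ ^ b = 0)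
    (hsum : b ≤ ∑ t ∈ T, (d + 1 - a t)) (j : ℕ) (hj : j ≤ d) :
    (d.choose j : A) * (θ ^ j * η ^ (d - j)) = 0 := by
  nontriviality A
  let p : A[X] := (C θ * X + C η) ^ d
  have hcoeff : ∀ i, p.coeff i = if i ≤ d then (d.choose i : A) * (θ ^ i * η ^ (d - i)) else 0 := by
    intro i
    have : p = ∑ k ∈ Finset.range (d + 1),
        C ((d.choose k : A) * (θ ^ k * η ^ (d - k))) * X ^ k := by
      simp only [p, add_pow]
      refine Finset.sum_congr rfl fun k _ => ?_
      simp only [map_mul, map_pow, map_natCast]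
      ring
    rw [this, finsetSum_coeff]
    simp only [coeff_C_mul_X_pow]
    rw [Finset.sum_ite_eq]
    simp
  let q : A[X] := ∏ t ∈ T, (X - C (algebraMap K A t)) ^ (d + 1 - a t)
  have hq : q.Monic := monic_prod_of_monic _ _ fun t _ => (monic_X_sub_C _).pow _
  have hqdeg : q.natDegree = ∑ t ∈ T, (d + 1 - a t) := by
    rw [natDegree_prod_of_monic _ _ fun t _ => (monic_X_sub_C _).pow _]
    exact Finset.sum_congr rfl fun t _ => by
      rw [(monic_X_sub_C _).natDegree_pow, natDegree_X_sub_C, mul_one]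
  -- Write $\theta X+\eta=(\eta+t\theta)+(X-t)\theta$ and expand: terms with at least $a_t$ factors
  -- of the first kind vanish, all others contain $(X-t)^{d+1-a_t}$. Distinct scalars make these
  -- divisors coprime.
  have hdvd : q ∣ p := by
    refine Finset.prod_dvd_of_coprime (fun s _ t _ hst => ?_) fun t ht => ?_
    · refine IsCoprime.pow (isCoprime_X_sub_C_of_isUnit_sub ?_)
      rw [← map_sub]
      exact (IsUnit.mk0 _ (sub_ne_zero.2 hst)).map (algebraMap K A)
    · have h1 : C θ * X + C η =
          C (η + t • θ) + (X - C (algebraMap K A t)) * C θ := by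
        rw [Algebra.smul_def, map_add, map_mul]; ring
      simp only [p]
      rw [h1, add_pow]
      refine Finset.dvd_sum fun k _ => ?_
      by_cases hk : a t ≤ k
      · rw [← map_pow, pow_eq_zero_of_le hk (hT t ht)]
        simp
      · rw [mul_pow]
        exact (((pow_dvd_pow _ (by omega)).mul_right _).mul_left _).mul_right _
  -- Coefficients of index at least $b$ vanish, because the index exceeds $d$ or because
  -- $\theta^b=0$; so $p$ has degree below $b$, yet it is divisible by a monic polynomial of degree
  -- at least $b$.
  have hp0 : p = 0 := by
    by_contra hne
    refine hq.not_dvd_of_degree_lt hne ?_ hdvd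
    rw [degree_eq_natDegree hq.ne_zero, hqdeg]
    refine lt_of_lt_of_le ?_ (Nat.cast_le.2 hsum)
    rw [degree_lt_iff_coeff_zero]
    intro i hi
    rw [hcoeff]
    split_ifs with hid
    · rw [pow_eq_zero_of_le hi (hθ (hi.trans hid))]; simp
    · rfl
  have := hcoeff j
  rw [hp0, coeff_zero, if_pos hj] at this
  exact this.symm

variable {U : Type*} [AddCommGroup U] [Module K U]

/-- This is `pencil_eq_zero` in $\operatorname{Sym}(V)$ modulo the annihilator of $f$.
Characteristic zero removes the binomial coefficient. When $b>d$ nothing is required of $\theta$. -/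
theorem pencil_apply [CharZero K] {f : SymmetricAlgebra K U} {η θ : Dual K U} {T : Finset K}
    {a : K → ℕ} {d b : ℕ} (hT : ∀ t ∈ T, (dirDerivEnd K (η + t • θ) ^ a t) f = 0)
    (hθ : b ≤ d → (dirDerivEnd K θ ^ b) f = 0)
    (hsum : b ≤ ∑ t ∈ T, (d + 1 - a t)) {j : ℕ} (hj : j ≤ d) :
    (dirDerivEnd K η ^ (d - j)) ((dirDerivEnd K θ ^ j) f) = 0 := by
  let I := annIdeal K f
  let m := Ideal.Quotient.mkₐ K I
  let i := SymmetricAlgebra.ι K (Dual K U)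
  have hm : ∀ q, m q = 0 ↔ q ∈ I := fun q => Ideal.Quotient.eq_zero_iff_mem
  have h := pencil_eq_zero K (η := m (i η)) (θ := m (i θ)) (T := T) (a := a) (d := d) (b := b)
    (fun t ht => by
      rw [← map_smul, ← map_smul, ← map_add, ← map_add, ← map_pow, hm]
      exact (ι_pow_mem_annIdeal K).2 (hT t ht))
    (fun hb => by
      rw [← map_pow, hm]
      exact (ι_pow_mem_annIdeal K).2 (hθ hb)) hsum j hj
  rw [← map_pow m, ← map_pow m, ← map_mul m, ← map_natCast m, ← map_mul m, hm] at h
  have h2 : diffOp K ((d.choose j : SymmetricAlgebra K (Dual K U)) * (i θ ^ j * i η ^ (d - j))) f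
    = 0 := h
  have hc : (d.choose j : SymmetricAlgebra K (Dual K U)) =
      algebraMap K _ (d.choose j : K) := by simp
  rw [hc, ← Algebra.smul_def, map_smul, LinearMap.smul_apply, mul_comm (i θ ^ j), map_mul,
    diffOp_ι_pow, diffOp_ι_pow] at h2
  exact (smul_eq_zero.1 h2).resolve_left (by exact_mod_cast (Nat.choose_pos hj).ne')

theorem pencil_apply' [CharZero K] {f : SymmetricAlgebra K U} {η θ : Dual K U} {T : Finset K}
    {a : K → ℕ} {d b : ℕ} (hT : ∀ t ∈ T, (dirDerivEnd K (η + t • θ) ^ a t) f = 0)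
    (hθ : b ≤ d → (dirDerivEnd K θ ^ b) f = 0)
    (hsum : b ≤ ∑ t ∈ T, (d + 1 - a t)) : (dirDerivEnd K η ^ d) f = 0 := by
  simpa using pencil_apply K hT hθ hsum (Nat.zero_le d)

/-- A family of powers of directional derivatives that kills `f` for all but finitely many members
`η + t θ` of a pencil also kills it for `η`. -/
theorem generic_pencil_apply [CharZero K] {f : SymmetricAlgebra K U} {η θ : Dual K U}
    {B : Set K} (hB : B.Finite) {e : ℕ}
    (h : ∀ t, t ∉ B → (dirDerivEnd K (η + t • θ) ^ e) f = 0) :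
    (dirDerivEnd K η ^ e) f = 0 := by
  obtain ⟨T, hT, hcard⟩ := hB.infinite_compl.exists_subset_card_eq (e + 1)
  refine pencil_apply' K (T := T) (a := fun _ => e) (b := e + 1) (fun t ht => h t (hT ht))
    (fun hb => absurd hb (by omega)) ?_
  simp [hcard]

end Pencils

/-! ### Kernels of power ideals as spaces of polynomials; left exactness. -/

section PowerKernels

variable (K : Type*) [Field K] {U : Type*} [AddCommGroup U] [Module K U]

/-- The elements of `Sym U` killed by `D_η ^ e(η)` for all `η ≠ 0`. -/
def powKer (e : Dual K U → ℕ) : Submodule K (SymmetricAlgebra K U) where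
  carrier := {f | ∀ η, η ≠ 0 → (dirDerivEnd K η ^ e η) f = 0}
  add_mem' ha hb η hη := by rw [map_add, ha η hη, hb η hη, add_zero]
  zero_mem' _ _ := map_zero _
  smul_mem' c f hf η hη := by rw [map_smul, hf η hη, smul_zero]

theorem powKer_mono {e e' : Dual K U → ℕ} (h : ∀ η, η ≠ 0 → e η ≤ e' η) :
    powKer K e ≤ powKer K e' :=
  fun _ hf η hη => pow_apply_eq_zero_of_le K (hf η hη) (h η hη)

theorem isGraded_powKer (e : Dual K U → ℕ) : IsGraded K (powKer K e) :=
  isGraded_of_homComp_mem K fun _ hf n η hη => dirDerivEnd_pow_homComp_eq_zero K (hf η hη) n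

open Classical in
/-- The number of members of `X` outside the hyperplane `η = 0`. -/
def numOff (X : Multiset U) (η : Dual K U) : ℕ := X.countP fun z => η z ≠ 0

/-- The span of the members of `X` in the hyperplane `η = 0`. -/
def spanIn (X : Multiset U) (η : Dual K U) : Submodule K U :=
  Submodule.span K {z | z ∈ X ∧ η z = 0}

open Classical in
/-- The exponent `m(η) + k + χ(η)`, for an upper set `S` of subspaces. -/
def powExp (k : ℤ) (S : Set (Submodule K U)) (X : Multiset U) (η : Dual K U) : ℕ :=
  ((numOff K X η : ℤ) + k + (if spanIn K X η ∈ S then 1 else 0)).toNat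

variable {K}

theorem numOff_cons_of_eq {x : U} {η : Dual K U} (h : η x = 0) (X : Multiset U) :
    numOff K (x ::ₘ X) η = numOff K X η := by
  classical
  exact Multiset.countP_cons_of_neg _ (by simpa using h)

theorem numOff_cons_of_ne {x : U} {η : Dual K U} (h : η x ≠ 0) (X : Multiset U) :
    numOff K (x ::ₘ X) η = numOff K X η + 1 := by
  classical
  exact Multiset.countP_cons_of_pos (p := fun z => η z ≠ 0) _ h

theorem numOff_zero (η : Dual K U) : numOff K 0 η = 0 := rfl

theorem numOff_eq_zero_iff {X : Multiset U} {η : Dual K U} :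
    numOff K X η = 0 ↔ ∀ z ∈ X, η z = 0 := by
  classical
  simp [numOff, Multiset.countP_eq_zero]

theorem numOff_pos_iff {X : Multiset U} {η : Dual K U} :
    0 < numOff K X η ↔ ∃ z ∈ X, η z ≠ 0 := by
  rw [Nat.pos_iff_ne_zero, Ne, numOff_eq_zero_iff]
  push Not
  rfl

theorem numOff_congr {X : Multiset U} {η θ : Dual K U} (h : ∀ z ∈ X, η z = 0 ↔ θ z = 0) :
    numOff K X η = numOff K X θ := by
  classical
  exact Multiset.countP_congr rfl fun z hz => by simpa using not_congr (h z hz)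

theorem numOff_mono {X : Multiset U} {η θ : Dual K U} (h : ∀ z ∈ X, η z = 0 → θ z = 0) :
    numOff K X θ ≤ numOff K X η := by
  induction X using Multiset.induction with
  | empty => simp [numOff_zero]
  | cons x X ih =>
    have ih := ih fun z hz => h z (Multiset.mem_cons_of_mem hz)
    have hx := h x (Multiset.mem_cons_self _ _)
    by_cases h1 : θ x = 0
    · rw [numOff_cons_of_eq h1]
      by_cases h2 : η x = 0
      · rwa [numOff_cons_of_eq h2]
      · rw [numOff_cons_of_ne h2]; omega
    · rw [numOff_cons_of_ne h1, numOff_cons_of_ne (mt hx h1)]; omega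

theorem numOff_map {U' : Type*} [AddCommGroup U'] [Module K U'] (p : U →ₗ[K] U') (X : Multiset U)
    (η : Dual K U') : numOff K (X.map p) η = numOff K X (η ∘ₗ p) := by
  classical
  simp only [numOff, Multiset.countP_map]
  rw [Multiset.countP_eq_card_filter]
  rfl

theorem spanIn_le_ker (X : Multiset U) (η : Dual K U) : spanIn K X η ≤ LinearMap.ker η :=
  Submodule.span_le.2 fun _ hz => hz.2

theorem mem_spanIn {X : Multiset U} {η : Dual K U} {z : U} (hz : z ∈ X) (h : η z = 0) :
    z ∈ spanIn K X η := Submodule.subset_span ⟨hz, h⟩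

theorem spanIn_mono {X : Multiset U} {η θ : Dual K U} (h : ∀ z ∈ X, η z = 0 → θ z = 0) :
    spanIn K X η ≤ spanIn K X θ :=
  Submodule.span_mono fun z hz => ⟨hz.1, h z hz.1 hz.2⟩

theorem spanIn_congr {X : Multiset U} {η θ : Dual K U} (h : ∀ z ∈ X, η z = 0 ↔ θ z = 0) :
    spanIn K X η = spanIn K X θ :=
  le_antisymm (spanIn_mono fun z hz => (h z hz).1) (spanIn_mono fun z hz => (h z hz).2)

theorem spanIn_cons_of_ne {x : U} {η : Dual K U} (h : η x ≠ 0) (X : Multiset U) :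
    spanIn K (x ::ₘ X) η = spanIn K X η := by
  refine congrArg (Submodule.span K) (Set.ext fun z => ?_)
  constructor
  · rintro ⟨h1, h2⟩
    rcases Multiset.mem_cons.1 h1 with rfl | h1
    · exact absurd h2 h
    · exact ⟨h1, h2⟩
  · rintro ⟨h1, h2⟩
    exact ⟨Multiset.mem_cons_of_mem h1, h2⟩

theorem spanIn_cons_of_eq {x : U} {η : Dual K U} (h : η x = 0) (X : Multiset U) :
    spanIn K (x ::ₘ X) η = spanIn K X η ⊔ Submodule.span K {x} := by
  rw [spanIn, spanIn, ← Submodule.span_union]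
  refine congrArg (Submodule.span K) (Set.ext fun z => ?_)
  constructor
  · rintro ⟨h1, h2⟩
    rcases Multiset.mem_cons.1 h1 with rfl | h1
    · exact Or.inr rfl
    · exact Or.inl ⟨h1, h2⟩
  · rintro (⟨h1, h2⟩ | rfl)
    · exact ⟨Multiset.mem_cons_of_mem h1, h2⟩
    · exact ⟨Multiset.mem_cons_self _ _, h⟩

/-- The image of an upper set of subspaces under contraction. -/
def quotUpper (S : Set (Submodule K U)) (x : U) :
    Set (Submodule K (U ⧸ Submodule.span K {x})) :=
  {W | W.comap (Submodule.span K {x}).mkQ ∈ S}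

theorem isUpperSet_quotUpper {S : Set (Submodule K U)} (hS : IsUpperSet S) (x : U) :
    IsUpperSet (quotUpper S x) :=
  fun _ _ h h' => hS (Submodule.comap_mono h) h'

theorem comap_span_map (x : U) (Z : Set U) :
    (Submodule.span K ((Submodule.span K {x}).mkQ '' Z)).comap (Submodule.span K {x}).mkQ =
      Submodule.span K Z ⊔ Submodule.span K {x} := by
  rw [Submodule.span_image, Submodule.comap_map_mkQ, sup_comm]

theorem comp_mkQ_apply_self {x : U} (η : Dual K (U ⧸ Submodule.span K {x})) :
    (η ∘ₗ (Submodule.span K {x}).mkQ) x = 0 := by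
  have h : (Submodule.span K {x}).mkQ x = 0 := by simp
  rw [LinearMap.comp_apply, h, map_zero]

theorem comap_spanIn_map (x : U) (X : Multiset U) (η : Dual K (U ⧸ Submodule.span K {x})) :
    (spanIn K (X.map (Submodule.span K {x}).mkQ) η).comap (Submodule.span K {x}).mkQ =
      spanIn K (x ::ₘ X) (η ∘ₗ (Submodule.span K {x}).mkQ) := by
  have hx := comp_mkQ_apply_self η
  rw [spanIn_cons_of_eq hx, spanIn, spanIn, ← comap_span_map]
  congr 2
  ext w
  constructor
  · rintro ⟨h1, h2⟩
    obtain ⟨z, hz, rfl⟩ := Multiset.mem_map.1 h1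
    exact ⟨z, ⟨hz, h2⟩, rfl⟩
  · rintro ⟨z, ⟨hz, h2⟩, rfl⟩
    exact ⟨Multiset.mem_map_of_mem _ hz, h2⟩

theorem comp_mkQ_ne_zero {x : U} {η : Dual K (U ⧸ Submodule.span K {x})} (hη : η ≠ 0) :
    η ∘ₗ (Submodule.span K {x}).mkQ ≠ 0 := by
  intro h
  apply hη
  ext u
  simpa using LinearMap.congr_fun h u

theorem powExp_map (k : ℤ) (S : Set (Submodule K U)) (x : U) (X : Multiset U)
    (η : Dual K (U ⧸ Submodule.span K {x})) :
    powExp K k (quotUpper S x) (X.map (Submodule.span K {x}).mkQ) η =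
      powExp K k S (x ::ₘ X) (η ∘ₗ (Submodule.span K {x}).mkQ) := by
  have hx := comp_mkQ_apply_self η
  rw [powExp, powExp, numOff_map, numOff_cons_of_eq hx, ← comap_spanIn_map]
  rfl

/-- Functionals on $U/x$ are the functionals on $U$ that vanish at $x$, and the exponents agree
under this identification. -/
theorem symMap_mem_powKer (k : ℤ) (S : Set (Submodule K U)) (x : U) (X : Multiset U)
    {g : SymmetricAlgebra K U} (hg : g ∈ powKer K (powExp K k S (x ::ₘ X))) :
    symMap K (Submodule.span K {x}).mkQ g ∈
      powKer K (powExp K k (quotUpper S x) (X.map (Submodule.span K {x}).mkQ)) := by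
  intro η hη
  rw [powExp_map, ← symMap_dirDerivEnd_pow, hg _ (comp_mkQ_ne_zero hη), map_zero]

theorem powExp_zero_cons (k : ℤ) (S : Set (Submodule K U)) (X : Multiset U) :
    powExp K k S (0 ::ₘ X) = powExp K k S X := by
  ext η
  rw [powExp, powExp, numOff_cons_of_eq (map_zero η), spanIn_cons_of_eq (map_zero η),
    Submodule.span_zero_singleton, sup_bot_eq]

/-- If $\eta(x)=0$, then $p_x$ is a constant for $D_\eta$ and the exponent does not decrease, since
$S$ is an upper set. If $\eta(x)\ne0$, the extra derivative is paid for by $x$ being counted in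
$m(\eta)$. -/
theorem ι_mul_mem_powKer (k : ℤ) {S : Set (Submodule K U)} (hS : IsUpperSet S) (x : U)
    (X : Multiset U) {f : SymmetricAlgebra K U} (hf : f ∈ powKer K (powExp K k S X)) :
    SymmetricAlgebra.ι K U x * f ∈ powKer K (powExp K k S (x ::ₘ X)) := by
  intro η hη
  have h1 := hf η hη
  by_cases hx : η x = 0
  · rw [dirDerivEnd_pow_ι_mul_of_apply_eq_zero K hx]
    rw [pow_apply_eq_zero_of_le K h1, mul_zero]
    rw [powExp, powExp, numOff_cons_of_eq hx, spanIn_cons_of_eq hx]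
    apply Int.toNat_le_toNat
    have := hS (le_sup_left : spanIn K X η ≤ spanIn K X η ⊔ Submodule.span K {x})
    split_ifs with h2 h3
    · exact le_rfl
    · exact absurd (this h2) h3
    · omega
    · exact le_rfl
  · have he : powExp K k S (x ::ₘ X) η =
        ((numOff K X η : ℤ) + k + (open Classical in if spanIn K X η ∈ S then 1 else 0) + 1).toNat := by
      rw [powExp, numOff_cons_of_ne hx, spanIn_cons_of_ne hx]
      congr 1
      push_cast
      ring
    rw [he]
    rw [powExp] at h1
    -- A negative integer exponent is truncated to $0$, so it does not grow with $m$; but then the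
    -- condition at $\eta$ already says $f=0$.
    rcases lt_or_ge ((numOff K X η : ℤ) + k +
      (open Classical in if spanIn K X η ∈ S then 1 else 0)) (0 : ℤ) with h | h
    · rw [Int.toNat_of_nonpos h.le] at h1
      have : f = 0 := by simpa using h1
      simp [this]
    · rw [Int.toNat_add h zero_le_one, Int.toNat_one, dirDerivEnd_pow_succ_ι_mul, h1,
        pow_succ_apply, h1]
      simp

theorem ι_ne_zero {x : U} (hx : x ≠ 0) : SymmetricAlgebra.ι K U x ≠ 0 := by
  intro h
  refine hx ((Module.forall_dual_apply_eq_zero_iff K x).1 fun θ => ?_)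
  have := dirDerivEnd_ι K θ x
  rwa [h, map_zero, eq_comm, SymmetricAlgebra.algebraMap_eq_zero_iff] at this

theorem mem_powKer_of_ι_mul_mem [CharZero K] (k : ℤ) {S : Set (Submodule K U)} (hS : IsUpperSet S)
    {x : U} (hx0 : x ≠ 0) [FiniteDimensional K U]
    (X : Multiset U) {f : SymmetricAlgebra K U}
    (hf : SymmetricAlgebra.ι K U x * f ∈ powKer K (powExp K k S (x ::ₘ X))) :
    f ∈ powKer K (powExp K k S X) := by
  have hne : ∀ η : Dual K U, η x ≠ 0 → (dirDerivEnd K η ^ powExp K k S X η) f = 0 := by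
    intro η hx
    have hη : η ≠ 0 := by rintro rfl; exact hx rfl
    refine pow_apply_eq_zero_of_le K (dirDerivEnd_pow_pred_of_ι_mul K hx (hf η hη)) ?_
    rw [powExp, powExp, numOff_cons_of_ne hx, spanIn_cons_of_ne hx]
    omega
  intro η hη
  by_cases hx : η x = 0
  swap
  · exact hne η hx
  -- With $\eta(x)=0$, this is the only case in which the exponents of $X$ and $x,X$ at $\eta$
  -- differ.
  by_cases hS' : spanIn K X η ∉ S ∧ spanIn K X η ⊔ Submodule.span K {x} ∈ S
  · have hxS : x ∉ spanIn K X η := by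
      intro h
      refine hS'.1 ?_
      have := hS'.2
      rwa [sup_eq_left.2 ((Submodule.span_singleton_le_iff_mem _ _).2 h)] at this
    obtain ⟨θ, hθx, hθ⟩ := Submodule.exists_dual_map_eq_bot_of_notMem hxS inferInstance
    have hθ' : ∀ z ∈ spanIn K X η, θ z = 0 := fun z hz => by
      have : θ z ∈ (spanIn K X η).map θ := Submodule.mem_map_of_mem hz
      rwa [hθ, Submodule.mem_bot] at this
    -- The parameters to avoid: $t=0$, where the functional vanishes at $x$, and those $t$ for which
    -- $\eta+t\theta$ vanishes at a further member of $X$. For all others the flat, and hence the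
    -- exponent, is that of $\eta$.
    let B : Set K := insert 0 ((fun z => -η z / θ z) '' {z | z ∈ X})
    have hB : B.Finite := by
      classical
      refine Set.Finite.insert _ (Set.Finite.image _ ?_)
      exact X.toFinset.finite_toSet.subset fun z hz => by simpa using hz
    refine generic_pencil_apply K hB (η := η) (θ := θ) fun t ht => ?_
    have ht0 : t ≠ 0 := fun h => ht (h ▸ Set.mem_insert _ _)
    have hflat : ∀ z ∈ X, (η + t • θ) z = 0 ↔ η z = 0 := by
      intro z hz
      constructor
      · intro h
        by_contra hηz
        have hθz : θ z ≠ 0 := by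
          intro h0
          simp [h0] at h
          exact hηz h
        refine ht (Or.inr ⟨z, hz, ?_⟩)
        simp only [LinearMap.add_apply, LinearMap.smul_apply, smul_eq_mul] at h
        field_simp
        linear_combination -h
      · intro h
        simp [h, hθ' z (mem_spanIn hz h)]
    have h1 := hne (η + t • θ) (by simp [hx, ht0, hθx])
    have h2 : powExp K k S X (η + t • θ) = powExp K k S X η := by
      rw [powExp, powExp, numOff_congr hflat, spanIn_congr hflat]
    rwa [h2] at h1
  · have h1 := hf η hη
    have he : powExp K k S (x ::ₘ X) η = powExp K k S X η := by
      rw [powExp, powExp, numOff_cons_of_eq hx, spanIn_cons_of_eq hx]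
      have := hS (le_sup_left : spanIn K X η ≤ spanIn K X η ⊔ Submodule.span K {x})
      congr 2
      split_ifs with h2 h3 <;> tauto
    rw [he, dirDerivEnd_pow_ι_mul_of_apply_eq_zero K hx] at h1
    exact (mul_eq_zero.1 h1).resolve_left (ι_ne_zero hx0)

end PowerKernels

/-! ### Polynomials of bounded degree. -/

section LowDegree

variable (K : Type*) [Field K] {M : Type*} [AddCommGroup M] [Module K M]

/-- The elements of `Sym M` of degree less than `n`. -/
def lowDeg (n : ℕ) : Submodule K (SymmetricAlgebra K M) where
  carrier := {f | ∀ j, n ≤ j → homComp K j f = 0}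
  add_mem' ha hb j hj := by rw [map_add, ha j hj, hb j hj, add_zero]
  zero_mem' _ _ := map_zero _
  smul_mem' c f hf j hj := by rw [map_smul, hf j hj, smul_zero]

theorem symMap_homComp {M' : Type*} [AddCommGroup M'] [Module K M'] (p : M →ₗ[K] M') (n : ℕ)
    (f : SymmetricAlgebra K M) : symMap K p (homComp K n f) = homComp K n (symMap K p f) := by
  refine homogeneous_induction K ?_ ?_ ?_ f
  · intro j g hg
    rw [homComp_of_mem K hg, homComp_of_mem K (symMap_mem_symDegree K p hg)]
    split_ifs <;> simp
  · simp
  · intro a b ha hb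
    simp only [map_add, ha, hb]

theorem symMap_mem_lowDeg {M' : Type*} [AddCommGroup M'] [Module K M'] (p : M →ₗ[K] M') {n : ℕ}
    {f : SymmetricAlgebra K M} (hf : f ∈ lowDeg K n) : symMap K p f ∈ lowDeg K n := by
  intro j hj
  rw [← symMap_homComp, hf j hj, map_zero]

theorem dirDerivEnd_pow_of_mem_lowDeg (η : Dual K M) {n : ℕ} {f : SymmetricAlgebra K M}
    (hf : f ∈ lowDeg K n) : (dirDerivEnd K η ^ n) f = 0 := by
  refine eq_zero_of_homComp K fun j => ?_
  rw [homComp_dirDerivEnd_pow, hf _ (Nat.le_add_left _ _), map_zero]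

theorem mem_lowDeg_of_subsingleton [Subsingleton M] (n : ℕ) (f : SymmetricAlgebra K M) :
    f ∈ lowDeg K (n + 1) := by
  intro j hj
  obtain ⟨i, rfl⟩ : ∃ i, j = i + 1 := ⟨j - 1, by omega⟩
  refine symDegree_succ_induction K ?_ ?_ (homComp_mem K (i + 1) f)
  · intro m g _
    rw [Subsingleton.elim m 0, map_zero, zero_mul]
  · intro a b ha hb
    rw [ha, hb, add_zero]

/-- Components of degree $j\ge n$ vanish at all $\eta\ne0$. At $\eta=0$ a form of positive degree
vanishes anyway; a constant needs one non-zero $\eta$, which is why $M\neq0$ is assumed. -/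
theorem mem_lowDeg_of_dirDerivEnd_pow [CharZero K] [FiniteDimensional K M] [Nontrivial M] {n : ℕ}
    {f : SymmetricAlgebra K M} (h : ∀ η : Dual K M, η ≠ 0 → (dirDerivEnd K η ^ n) f = 0) :
    f ∈ lowDeg K n := by
  intro j hj
  have key : ∀ η : Dual K M, η ≠ 0 → evalAt K η (homComp K j f) = 0 := by
    intro η hη
    have h1 := pow_apply_eq_zero_of_le K
      (dirDerivEnd_pow_homComp_eq_zero K (h η hη) j) hj
    rw [dirDerivEnd_pow_of_mem K η (homComp_mem K j f),
      SymmetricAlgebra.algebraMap_eq_zero_iff] at h1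
    exact (mul_eq_zero.1 h1).resolve_left (by exact_mod_cast j.factorial_ne_zero)
  obtain ⟨η, hη⟩ := exists_ne (0 : Dual K M)
  refine eq_zero_of_evalAt K fun θ => ?_
  rcases j with _ | j
  · obtain ⟨c, hc⟩ := (mem_symDegree_zero K).1 (homComp_mem K 0 f)
    have := key η hη
    rw [← hc, AlgHom.commutes] at this ⊢
    exact this
  · by_cases hθ : θ = 0
    · subst hθ
      refine symDegree_succ_induction K ?_ ?_ (homComp_mem K (j + 1) f)
      · intro m g _
        simp [evalAt]
      · intro a b ha hb
        rw [map_add, ha, hb, add_zero]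
    · exact key θ hθ

end LowDegree

/-! ### Spaces spanned by products of vectors. -/

section ProductSpaces

variable (K : Type*) [Field K] {U : Type*} [AddCommGroup U] [Module K U]

/-- The span of the members of `X`. -/
def spanAll (X : Multiset U) : Submodule K U := Submodule.span K {z | z ∈ X}

variable {K}

theorem spanAll_cons (x : U) (X : Multiset U) :
    spanAll K (x ::ₘ X) = spanAll K X ⊔ Submodule.span K {x} := by
  rw [spanAll, spanAll, ← Submodule.span_union]
  congr 1
  ext z
  simp

theorem comap_spanAll_map (x : U) (X : Multiset U) :
    (spanAll K (X.map (Submodule.span K {x}).mkQ)).comap (Submodule.span K {x}).mkQ =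
      spanAll K (x ::ₘ X) := by
  rw [spanAll_cons, spanAll, spanAll, ← comap_span_map]
  congr 2
  ext w
  simp

theorem spanAll_map_eq_top_iff (x : U) (X : Multiset U) :
    spanAll K (X.map (Submodule.span K {x}).mkQ) = ⊤ ↔ spanAll K (x ::ₘ X) = ⊤ := by
  rw [← comap_spanAll_map]
  constructor
  · intro h
    rw [h, Submodule.comap_top]
  · intro h
    exact Submodule.comap_injective_of_surjective (Submodule.mkQ_surjective _)
      (h.trans (Submodule.comap_top _).symm)

theorem spanAll_le_spanIn {X Z : Multiset U} {η : Dual K U} (hZ : Z ≤ X) (h : ∀ z ∈ Z, η z = 0) :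
    spanAll K Z ≤ spanIn K X η :=
  Submodule.span_mono fun z hz => ⟨Multiset.mem_of_le hZ hz, h z hz⟩

theorem numOff_add (Y Z : Multiset U) (η : Dual K U) :
    numOff K (Y + Z) η = numOff K Y η + numOff K Z η := by
  classical
  exact Multiset.countP_add _ _ _

theorem exists_mem_ne_zero_of_spanAll_eq_top {X : Multiset U} (hX : spanAll K X = ⊤)
    {η : Dual K U} (hη : η ≠ 0) : ∃ z ∈ X, η z ≠ 0 := by
  by_contra! h
  apply hη
  have h1 : spanAll K X ≤ LinearMap.ker η := Submodule.span_le.2 fun z hz => h z hz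
  rw [hX, top_le_iff] at h1
  exact LinearMap.ker_eq_top.1 h1

variable (K)

open Classical in
/-- The space spanned by the products `f ∏ Y` with `Y + Z = X` and `deg f < k + χ(span Z)`. -/
def prodSpace (k : ℕ) (S : Set (Submodule K U)) (X : Multiset U) :
    Submodule K (SymmetricAlgebra K U) :=
  Submodule.span K {g | ∃ Y Z, ∃ f ∈ lowDeg K (k + if spanAll K Z ∈ S then 1 else 0),
    Y + Z = X ∧ g = f * (Y.map (SymmetricAlgebra.ι K U)).prod}

variable {K}

open Classical in
theorem mul_prod_mem_prodSpace {k : ℕ} {S : Set (Submodule K U)} {X Y Z : Multiset U}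
    {f : SymmetricAlgebra K U} (hf : f ∈ lowDeg K (k + if spanAll K Z ∈ S then 1 else 0))
    (hYZ : Y + Z = X) :
    f * (Y.map (SymmetricAlgebra.ι K U)).prod ∈ prodSpace K k S X :=
  Submodule.subset_span ⟨Y, Z, f, hf, hYZ, rfl⟩

/-- If $\eta$ vanishes on $Z$, then $\chi(\operatorname{span}Z)\le\chi(\eta)$ because $S$ is an
upper set. Otherwise $Z$ contributes at least one to $m(\eta)$, which covers
$\chi(\operatorname{span}Z)\le1$. -/
theorem prodSpace_le_powKer (k : ℕ) {S : Set (Submodule K U)} (hS : IsUpperSet S)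
    (X : Multiset U) : prodSpace K k S X ≤ powKer K (powExp K k S X) := by
  classical
  refine Submodule.span_le.2 ?_
  rintro _ ⟨Y, Z, f, hf, rfl, rfl⟩ η -
  have h1 := dirDerivEnd_pow_mul_eq_zero K η (dirDerivEnd_pow_of_mem_lowDeg K η hf)
    (dirDerivEnd_pow_prod_eq_zero K η Y)
  refine pow_apply_eq_zero_of_le K h1 ?_
  have h2 : (Y.filter fun z => η z ≠ 0).card = numOff K Y η :=
    (Multiset.countP_eq_card_filter _ _).symm
  rw [h2, powExp, numOff_add]
  rcases Nat.eq_zero_or_pos (numOff K Z η) with h | h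
  · have h3 := hS (spanAll_le_spanIn (Multiset.le_add_left Z Y) (numOff_eq_zero_iff.1 h))
    split_ifs with h4 h5
    · omega
    · exact absurd (h3 h4) h5
    · omega
    · omega
  · split_ifs <;> omega

theorem prodSpace_zero_cons_ge (k : ℕ) (S : Set (Submodule K U)) (X : Multiset U) :
    prodSpace K k S X ≤ prodSpace K k S (0 ::ₘ X) := by
  classical
  refine Submodule.span_le.2 ?_
  rintro _ ⟨Y, Z, f, hf, rfl, rfl⟩
  refine mul_prod_mem_prodSpace (Z := 0 ::ₘ Z) ?_ (by rw [Multiset.add_cons])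
  rwa [spanAll_cons, Submodule.span_zero_singleton, sup_bot_eq]

theorem ι_mul_mem_prodSpace (k : ℕ) (S : Set (Submodule K U)) (x : U) (X : Multiset U)
    {f : SymmetricAlgebra K U} (hf : f ∈ prodSpace K k S X) :
    SymmetricAlgebra.ι K U x * f ∈ prodSpace K k S (x ::ₘ X) := by
  classical
  induction hf using Submodule.span_induction with
  | mem g hg =>
    obtain ⟨Y, Z, f, hf, rfl, rfl⟩ := hg
    rw [mul_left_comm, ← Multiset.prod_cons, ← Multiset.map_cons]
    exact mul_prod_mem_prodSpace hf (by rw [Multiset.cons_add])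
  | zero => rw [mul_zero]; exact zero_mem _
  | add a b _ _ ha hb => rw [mul_add]; exact add_mem ha hb
  | smul c a _ ha => rw [mul_smul_comm]; exact Submodule.smul_mem _ _ ha

theorem exists_map_eq_add {A B : Type*} (p : A → B) {X : Multiset A} {Y Z : Multiset B}
    (h : Y + Z = X.map p) : ∃ Y' Z', Y' + Z' = X ∧ Y'.map p = Y ∧ Z'.map p = Z := by
  classical
  induction X using Multiset.induction generalizing Y Z with
  | empty =>
    rw [Multiset.map_zero, add_eq_zero] at h
    exact ⟨0, 0, rfl, by simp [h.1], by simp [h.2]⟩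
  | cons x X ih =>
    rw [Multiset.map_cons] at h
    have hx : p x ∈ Y + Z := h ▸ Multiset.mem_cons_self _ _
    rcases Multiset.mem_add.1 hx with hx | hx
    · obtain ⟨Y, rfl⟩ := Multiset.exists_cons_of_mem hx
      rw [Multiset.cons_add, Multiset.cons_inj_right] at h
      obtain ⟨Y', Z', rfl, rfl, rfl⟩ := ih h
      exact ⟨x ::ₘ Y', Z', Multiset.cons_add _ _ _, Multiset.map_cons _ _ _, rfl⟩
    · obtain ⟨Z, rfl⟩ := Multiset.exists_cons_of_mem hx
      rw [Multiset.add_cons, Multiset.cons_inj_right] at h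
      obtain ⟨Y', Z', rfl, rfl, rfl⟩ := ih h
      exact ⟨Y', x ::ₘ Z', Multiset.add_cons _ _ _, rfl, Multiset.map_cons _ _ _⟩

/-- Lift $f$ along a linear section and the factors to the vectors they come from, and put $x$ into
$Z$: the span of $x,Z$ is the preimage of the span of the images, so the degree bound is unchanged.
-/
theorem exists_lift_of_mem_prodSpace (k : ℕ) (S : Set (Submodule K U)) (x : U) (X : Multiset U)
    {h : SymmetricAlgebra K (U ⧸ Submodule.span K {x})}
    (hh : h ∈ prodSpace K k (quotUpper S x) (X.map (Submodule.span K {x}).mkQ)) :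
    ∃ g ∈ prodSpace K k S (x ::ₘ X), symMap K (Submodule.span K {x}).mkQ g = h := by
  classical
  obtain ⟨s, hs⟩ := exists_symMap_section K x
  induction hh using Submodule.span_induction with
  | mem g hg =>
    obtain ⟨Y, Z, f, hf, hYZ, rfl⟩ := hg
    obtain ⟨Y, Z, rfl, rfl, rfl⟩ := exists_map_eq_add _ hYZ
    refine ⟨symMap K s f * (Y.map (SymmetricAlgebra.ι K U)).prod,
      mul_prod_mem_prodSpace (Z := x ::ₘ Z) ?_ (by rw [Multiset.add_cons]), ?_⟩
    · rw [← comap_spanAll_map]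
      exact symMap_mem_lowDeg K s hf
    · rw [map_mul, hs, symMap_prod]
  | zero => exact ⟨0, zero_mem _, map_zero _⟩
  | add a b _ _ ha hb =>
    obtain ⟨a', ha', rfl⟩ := ha
    obtain ⟨b', hb', rfl⟩ := hb
    exact ⟨a' + b', add_mem ha' hb', map_add _ _ _⟩
  | smul c a _ ha =>
    obtain ⟨a', ha', rfl⟩ := ha
    exact ⟨c • a', Submodule.smul_mem _ _ ha', map_smul _ _ _⟩

end ProductSpaces

-- Product generators and surjectivity for non-negative $k$.

universe u

/-- Subtract from $g$ a product-space lift of its image over $U/x$, given by induction. The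
difference is $p_xf$, with $f$ in the kernel for the remaining vectors, so induction applies to $f$.
The space $U$ varies in the induction because of contraction. -/
theorem powKer_le_prodSpace_aux {K : Type*} [Field K] [CharZero K] (k n : ℕ) :
    ∀ {U : Type u} [AddCommGroup U] [Module K U] [FiniteDimensional K U]
      {S : Set (Submodule K U)} (_ : IsUpperSet S) (X : Multiset U) (_ : X.card = n)
      (_ : spanAll K X = ⊤ → ⊤ ∈ S), powKer K (powExp K k S X) ≤ prodSpace K k S X := by
  classical
  induction n with
  | zero =>
    intro U _ _ _ S hS X hX hST f hf
    rw [Multiset.card_eq_zero] at hX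
    subst hX
    have hbot : spanAll K (0 : Multiset U) = ⊥ := by simp [spanAll]
    have hf' : f ∈ lowDeg K (k + if spanAll K (0 : Multiset U) ∈ S then 1 else 0) := by
      rcases subsingleton_or_nontrivial U with hU | hU
      -- For $U=0$ there is no $\eta\ne0$ and `powKer` is everything; constants have degree below
      -- $k+1$ but not below $0$, so $\top\in S$ is needed when $k=0$.
      · rw [if_pos]
        · exact mem_lowDeg_of_subsingleton K k f
        · have h : spanAll K (0 : Multiset U) = ⊤ := Subsingleton.elim _ _
          rw [h]
          exact hST h
      · refine mem_lowDeg_of_dirDerivEnd_pow K fun η hη => ?_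
        have h1 := hf η hη
        have h2 : spanIn K (0 : Multiset U) η = spanAll K (0 : Multiset U) := by
          simp [spanIn, spanAll]
        rw [powExp, h2, numOff_zero] at h1
        convert h1 using 3
        split_ifs <;> simp
    have := mul_prod_mem_prodSpace (Y := 0) hf' (add_zero 0)
    simpa using this
  | succ n ih =>
    intro U _ _ _ S hS X hX hST g hg
    obtain ⟨x, X, rfl⟩ := Multiset.card_pos_iff_exists_mem.1 (by omega : 0 < X.card) |>.imp
      fun x hx => Multiset.exists_cons_of_mem hx
    rw [Multiset.card_cons, Nat.add_right_cancel_iff] at hX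
    have hST' : spanAll K X = ⊤ → ⊤ ∈ S := fun h => hST (by rw [spanAll_cons, h, top_sup_eq])
    by_cases hx : x = 0
    · subst hx
      rw [powExp_zero_cons] at hg
      exact prodSpace_zero_cons_ge k S X (ih hS X hX hST' hg)
    have h1 := ih (isUpperSet_quotUpper hS x) (X.map (Submodule.span K {x}).mkQ)
      (by rw [Multiset.card_map, hX])
      (fun h => hST ((spanAll_map_eq_top_iff x X).1 h)) (symMap_mem_powKer k S x X hg)
    obtain ⟨g₀, hg₀, hg₀'⟩ := exists_lift_of_mem_prodSpace k S x X h1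
    have h2 : symMap K (Submodule.span K {x}).mkQ (g - g₀) = 0 := by
      rw [map_sub, hg₀', sub_self]
    obtain ⟨f, hf⟩ := (symMap_mkQ_eq_zero_iff K x _).1 h2
    have h3 : SymmetricAlgebra.ι K U x * f ∈ powKer K (powExp K k S (x ::ₘ X)) := by
      rw [hf]
      exact sub_mem hg (prodSpace_le_powKer k hS _ hg₀)
    have h4 := ι_mul_mem_prodSpace k S x X
      (ih hS X hX hST' (mem_powKer_of_ι_mul_mem k hS hx X h3))
    rw [hf] at h4
    simpa using add_mem h4 hg₀

theorem powKer_eq_prodSpace {K : Type*} [Field K] [CharZero K] (k : ℕ) {U : Type u}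
    [AddCommGroup U] [Module K U] [FiniteDimensional K U] {S : Set (Submodule K U)}
    (hS : IsUpperSet S) (X : Multiset U) (hX : spanAll K X = ⊤ → ⊤ ∈ S) :
    powKer K (powExp K k S X) = prodSpace K k S X :=
  le_antisymm (powKer_le_prodSpace_aux k _ hS X rfl hX) (prodSpace_le_powKer k hS X)

theorem exists_lift_of_mem_powKer {K : Type*} [Field K] [CharZero K] (k : ℕ) {U : Type u}
    [AddCommGroup U] [Module K U] [FiniteDimensional K U] {S : Set (Submodule K U)}
    (hS : IsUpperSet S) (hS' : ⊤ ∈ S) (x : U) (X : Multiset U)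
    {h : SymmetricAlgebra K (U ⧸ Submodule.span K {x})}
    (hh : h ∈ powKer K (powExp K k (quotUpper S x) (X.map (Submodule.span K {x}).mkQ))) :
    ∃ g ∈ powKer K (powExp K k S (x ::ₘ X)), symMap K (Submodule.span K {x}).mkQ g = h := by
  rw [powKer_eq_prodSpace k (isUpperSet_quotUpper hS x) _ fun _ => hS'] at hh
  rw [powKer_eq_prodSpace k hS _ fun _ => hS']
  exact exists_lift_of_mem_prodSpace k S x X hh

/-! ### Reduction to hyperplanes and maximal missing flats. -/

section Flats

variable {K : Type*} [Field K] {U : Type*} [AddCommGroup U] [Module K U]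

theorem numOff_lt {X : Multiset U} {η θ : Dual K U} (h : ∀ z ∈ X, η z = 0 → θ z = 0)
    (h' : ∃ z ∈ X, η z ≠ 0 ∧ θ z = 0) : numOff K X θ < numOff K X η := by
  obtain ⟨z, hz, h1, h2⟩ := h'
  obtain ⟨X, rfl⟩ := Multiset.exists_cons_of_mem hz
  rw [numOff_cons_of_ne h1, numOff_cons_of_eq h2, Nat.lt_succ_iff]
  exact numOff_mono fun w hw => h w (Multiset.mem_cons_of_mem hw)

open Classical in
/-- The number of members of `X` in the hyperplane `θ = 0` but outside the hyperplane `η = 0`. -/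
def numOffIn (X : Multiset U) (θ η : Dual K U) : ℕ := X.countP fun z => θ z = 0 ∧ η z ≠ 0

theorem numOffIn_cons_of_ne {x : U} {θ η : Dual K U} (h : θ x ≠ 0) (X : Multiset U) :
    numOffIn (x ::ₘ X) θ η = numOffIn X θ η := by
  classical
  exact Multiset.countP_cons_of_neg _ (by simp [h])

theorem numOffIn_cons_of_eq {x : U} {θ η : Dual K U} (h : η x = 0) (X : Multiset U) :
    numOffIn (x ::ₘ X) θ η = numOffIn X θ η := by
  classical
  exact Multiset.countP_cons_of_neg _ (by simp [h])

theorem numOffIn_cons {x : U} {θ η : Dual K U} (h : θ x = 0) (h' : η x ≠ 0) (X : Multiset U) :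
    numOffIn (x ::ₘ X) θ η = numOffIn X θ η + 1 := by
  classical
  exact Multiset.countP_cons_of_pos (p := fun z => θ z = 0 ∧ η z ≠ 0) _ ⟨h, h'⟩

theorem numOffIn_pos_iff {X : Multiset U} {θ η : Dual K U} :
    0 < numOffIn X θ η ↔ ∃ z ∈ X, θ z = 0 ∧ η z ≠ 0 := by
  classical
  simp [numOffIn, Multiset.countP_pos]

/-- The members `η + t θ` of a pencil that contain more elements of `X` than the general one, and
the total number of these elements. -/
theorem exists_pencil_count (X : Multiset U) (η θ : Dual K U) :
    ∃ T : Finset K, (∀ z ∈ X, θ z ≠ 0 → -η z / θ z ∈ T) ∧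
      (∀ t ∈ T, ∃ z ∈ X, θ z ≠ 0 ∧ -η z / θ z = t) ∧
      (∀ t : K, numOff K X (η + t • θ) ≤ numOff K X θ + numOffIn X θ η) ∧
      ∑ t ∈ T, (numOff K X θ + numOffIn X θ η - numOff K X (η + t • θ)) = numOff K X θ := by
  classical
  -- The parameter of the unique pencil member that vanishes at $z$, when $\theta(z)\ne0$.
  let φ : U → K := fun z => -η z / θ z
  have H : ∀ (t : K) (Y : Multiset U), ((Y.filter fun z => θ z ≠ 0).map φ).count t +
      numOff K Y (η + t • θ) = numOff K Y θ + numOffIn Y θ η := by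
    intro t Y
    induction Y using Multiset.induction with
    | empty => simp [numOff_zero, numOffIn]
    | cons y Y ih =>
      by_cases hθ : θ y = 0
      · rw [Multiset.filter_cons_of_neg _ (by simpa using hθ), numOff_cons_of_eq hθ]
        by_cases hη : η y = 0
        · rw [numOff_cons_of_eq (by simp [hη, hθ]), numOffIn_cons_of_eq hη, ih]
        · rw [numOff_cons_of_ne (by simp [hη, hθ]), numOffIn_cons hθ hη]
          omega
      · rw [Multiset.filter_cons_of_pos (p := fun z => θ z ≠ 0) _ hθ, Multiset.map_cons,
          Multiset.count_cons, numOff_cons_of_ne hθ, numOffIn_cons_of_ne hθ]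
        have hφ : t = φ y ↔ (η + t • θ) y = 0 := by
          simp only [φ, LinearMap.add_apply, LinearMap.smul_apply, smul_eq_mul]
          rw [eq_div_iff hθ, eq_neg_iff_add_eq_zero, add_comm]
        by_cases ht : t = φ y
        · rw [if_pos ht, numOff_cons_of_eq (hφ.1 ht)]
          omega
        · rw [if_neg ht, numOff_cons_of_ne (mt hφ.2 ht)]
          omega
  refine ⟨((X.filter fun z => θ z ≠ 0).map φ).toFinset, fun z hz hθ => ?_, fun t ht => ?_,
    fun t => ?_, ?_⟩
  · exact Multiset.mem_toFinset.2 (Multiset.mem_map_of_mem _ (Multiset.mem_filter.2 ⟨hz, hθ⟩))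
  · obtain ⟨z, hz, rfl⟩ := Multiset.mem_map.1 (Multiset.mem_toFinset.1 ht)
    obtain ⟨hz, hθ⟩ := Multiset.mem_filter.1 hz
    exact ⟨z, hz, hθ, rfl⟩
  · have := H t X
    omega
  · have h1 : ∀ t : K, numOff K X θ + numOffIn X θ η - numOff K X (η + t • θ) =
        ((X.filter fun z => θ z ≠ 0).map φ).count t := fun t => by
      have := H t X
      omega
    simp only [h1]
    rw [Multiset.toFinset_sum_count_eq, Multiset.card_map, ← Multiset.countP_eq_card_filter]
    rfl

/-- When $\eta$ and $\theta$ define the same flat, each $z$ outside it lies on exactly one special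
member, so the drops of $m$ at the special members add up to $m(\eta)$. -/
theorem exists_pencil {X : Multiset U} {η θ : Dual K U} (h : ∀ z ∈ X, η z = 0 ↔ θ z = 0) :
    ∃ T : Finset K, (∀ t ∈ T, t ≠ 0 ∧ numOff K X (η + t • θ) < numOff K X η) ∧
      (∀ z ∈ X, η z ≠ 0 → -η z / θ z ∈ T) ∧
      ∑ t ∈ T, (numOff K X η - numOff K X (η + t • θ)) = numOff K X η := by
  obtain ⟨T, h1, h2, -, h3⟩ := exists_pencil_count X η θ
  have h0 : numOffIn X θ η = 0 := by
    by_contra hne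
    obtain ⟨z, hz, hθ, hη⟩ := numOffIn_pos_iff.1 (Nat.pos_of_ne_zero hne)
    exact hη ((h z hz).2 hθ)
  rw [h0, add_zero, ← numOff_congr h] at h3
  refine ⟨T, fun t ht => ?_, fun z hz hη => h1 z hz (mt (h z hz).2 hη), h3⟩
  obtain ⟨z, hz, hθ, rfl⟩ := h2 t ht
  have hη : η z ≠ 0 := mt (h z hz).1 hθ
  refine ⟨div_ne_zero (neg_ne_zero.2 hη) hθ, numOff_lt (fun w hw h0 => ?_) ⟨z, hz, hη, ?_⟩⟩
  · simp [h0, (h w hw).1 h0]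
  · simp only [LinearMap.add_apply, LinearMap.smul_apply, smul_eq_mul]
    rw [div_mul_cancel₀ _ hθ, add_neg_cancel]

/-- Adding a generic multiple of $\eta$ to $\theta$ makes the flats equal, so that `exists_pencil`
applies. -/
theorem exists_generic [Infinite K] (X : Multiset U) {η θ : Dual K U}
    (h : ∀ z ∈ X, η z = 0 → θ z = 0) :
    ∃ s : K, s ≠ 0 ∧ ∀ z ∈ X, η z = 0 ↔ (θ + s • η) z = 0 := by
  classical
  obtain ⟨s, hs⟩ := Infinite.exists_notMem_finset
    (insert 0 (X.toFinset.image fun z => -θ z / η z))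
  rw [Finset.mem_insert, not_or] at hs
  refine ⟨s, hs.1, fun z hz => ⟨fun h0 => by simp [h0, h z hz h0], fun h0 => ?_⟩⟩
  by_contra hη
  refine hs.2 (Finset.mem_image.2 ⟨z, by simpa using hz, ?_⟩)
  simp only [LinearMap.add_apply, LinearMap.smul_apply, smul_eq_mul] at h0
  rw [div_eq_iff hη]
  linear_combination -h0

theorem exists_dual_of_spanIn_ne_ker {X : Multiset U} {η : Dual K U}
    (h : spanIn K X η ≠ LinearMap.ker η) :
    ∃ (u : U) (θ : Dual K U), η u = 0 ∧ θ u ≠ 0 ∧ ∀ z ∈ X, η z = 0 → θ z = 0 := by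
  obtain ⟨u, hu, hu'⟩ := SetLike.exists_of_lt (lt_of_le_of_ne (spanIn_le_ker X η) h)
  obtain ⟨θ, hθu, hθ⟩ := Submodule.exists_dual_map_eq_bot_of_notMem hu' inferInstance
  refine ⟨u, θ, hu, hθu, fun z hz h0 => ?_⟩
  have : θ z ∈ (spanIn K X η).map θ := Submodule.mem_map_of_mem (mem_spanIn hz h0)
  rwa [hθ, Submodule.mem_bot] at this

/-- Strong induction on $m(\eta)$. A flat that is not a hyperplane has a second, independent normal;
the special members of the resulting pencil have smaller $m$, and their drops sum to $m(\eta)$, just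
enough for $d=m(\eta)-1$ with no condition on $\theta$. -/
theorem dirDerivEnd_pow_pred_of_hyperplanes [CharZero K] {X : Multiset U} (hX : spanAll K X = ⊤)
    {g : SymmetricAlgebra K U}
    (h : ∀ η : Dual K U, η ≠ 0 → spanIn K X η = LinearMap.ker η →
      (dirDerivEnd K η ^ numOff K X η) g = 0)
    {η : Dual K U} (hη : η ≠ 0) (hne : spanIn K X η ≠ LinearMap.ker η) :
    (dirDerivEnd K η ^ (numOff K X η - 1)) g = 0 := by
  induction hm : numOff K X η using Nat.strong_induction_on generalizing η with
  | _ m ih =>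
    subst hm
    obtain ⟨u, θ, hu, hθu, hθ⟩ := exists_dual_of_spanIn_ne_ker hne
    obtain ⟨s, -, hs⟩ := exists_generic X hθ
    obtain ⟨T, hT, -, hsum⟩ := exists_pencil hs
    have hpos := numOff_pos_iff.2 (exists_mem_ne_zero_of_spanAll_eq_top hX hη)
    refine pencil_apply' K (θ := θ + s • η) (T := T)
      (a := fun t => numOff K X (η + t • (θ + s • η))) (b := numOff K X η) (fun t ht => ?_)
      (fun hb => absurd hb (by omega)) ?_
    · have ht0 : η + t • (θ + s • η) ≠ 0 := by
        intro h0
        have := LinearMap.congr_fun h0 u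
        simp [hu, hθu, (hT t ht).1] at this
      by_cases hH : spanIn K X (η + t • (θ + s • η)) = LinearMap.ker (η + t • (θ + s • η))
      · exact h _ ht0 hH
      · exact pow_apply_eq_zero_of_le K (ih _ (hT t ht).2 ht0 hH rfl) (Nat.sub_le _ _)
    · rw [Nat.sub_add_cancel hpos]
      exact hsum.ge

theorem mem_powKer_neg_one_iff [CharZero K] {X : Multiset U} (hX : spanAll K X = ⊤)
    (S : Set (Submodule K U)) {g : SymmetricAlgebra K U} :
    g ∈ powKer K (powExp K (-1) S X) ↔
      ∀ η : Dual K U, η ≠ 0 → spanIn K X η = LinearMap.ker η →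
        (dirDerivEnd K η ^ powExp K (-1) S X η) g = 0 := by
  refine ⟨fun h η hη _ => h η hη, fun h η hη => ?_⟩
  by_cases hH : spanIn K X η = LinearMap.ker η
  · exact h η hη hH
  · refine pow_apply_eq_zero_of_le K (dirDerivEnd_pow_pred_of_hyperplanes hX
      (fun θ hθ hθ' => pow_apply_eq_zero_of_le K (h θ hθ hθ') ?_) hη hH) ?_
    · rw [powExp]; split_ifs <;> omega
    · rw [powExp]; split_ifs <;> omega

theorem spanIn_ne_top {X : Multiset U} {η : Dual K U} (hη : η ≠ 0) : spanIn K X η ≠ ⊤ := by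
  intro h
  have := spanIn_le_ker X η
  rw [h, top_le_iff] at this
  exact hη (LinearMap.ker_eq_top.1 this)

theorem powExp_singleton_top (k : ℤ) (X : Multiset U) {η : Dual K U} (hη : η ≠ 0) :
    powExp K k {⊤} X η = ((numOff K X η : ℤ) + k).toNat := by
  rw [powExp, if_neg (by simpa using spanIn_ne_top hη), add_zero]

/-- Both exponents equal $m$ at hyperplanes, and for $k=-1$ the hyperplane conditions imply all the
others. -/
theorem powKer_neg_one_eq_of_hyperplanes [CharZero K] {X : Multiset U} (hX : spanAll K X = ⊤)
    {S : Set (Submodule K U)}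
    (hS : ∀ η : Dual K U, η ≠ 0 → spanIn K X η = LinearMap.ker η → spanIn K X η ∈ S) :
    powKer K (powExp K (-1) S X) = powKer K (powExp K 0 {⊤} X) := by
  apply le_antisymm
  · refine powKer_mono K fun η hη => ?_
    rw [powExp_singleton_top _ _ hη, powExp]
    split_ifs <;> omega
  · intro g hg
    rw [mem_powKer_neg_one_iff hX]
    intro η hη hH
    refine pow_apply_eq_zero_of_le K (hg η hη) ?_
    rw [powExp_singleton_top _ _ hη, powExp, if_pos (hS η hη hH)]
    omega

theorem quotUpper_singleton_top (x : U) : quotUpper {⊤} x = ({⊤} : Set (Submodule K _)) := by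
  ext W
  simp only [quotUpper, Set.mem_singleton_iff, Set.mem_ofPred_eq]
  constructor
  · intro h
    exact Submodule.comap_injective_of_surjective (Submodule.mkQ_surjective _)
      (h.trans (Submodule.comap_top _).symm)
  · rintro rfl
    exact Submodule.comap_top _

theorem spanIn_mem_quotUpper {S : Set (Submodule K U)} {x : U} {X : Multiset U}
    (hS : ∀ η : Dual K U, η ≠ 0 → spanIn K (x ::ₘ X) η = LinearMap.ker η →
      spanIn K (x ::ₘ X) η ∈ S) (η : Dual K (U ⧸ Submodule.span K {x})) (hη : η ≠ 0)
    (h : spanIn K (X.map (Submodule.span K {x}).mkQ) η = LinearMap.ker η) :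
    spanIn K (X.map (Submodule.span K {x}).mkQ) η ∈ quotUpper S x := by
  have h1 := comap_spanIn_map x X η
  rw [quotUpper, Set.mem_ofPred_eq, h1]
  refine hS _ (comp_mkQ_ne_zero hη) ?_
  rw [← h1, h]
  rfl

/-- Strong induction on $m(\eta)$: every special member of a pencil satisfies its condition with
exponent at most $m+1$, so the drops alone provide total multiplicity $m(\eta)$ at $d=m(\eta)$. The
missing slack comes from a different source in each case. -/
theorem mem_powKer_zero_of [CharZero K] {X : Multiset U} (hX : spanAll K X = ⊤)
    {S : Set (Submodule K U)} {g : SymmetricAlgebra K U}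
    (hhyp : ∀ η : Dual K U, η ≠ 0 → spanIn K X η = LinearMap.ker η →
      (dirDerivEnd K η ^ powExp K 0 S X η) g = 0)
    (hmax : ∀ η : Dual K U, η ≠ 0 → spanIn K X η ∉ S →
      (∃ θ : Dual K U, (∀ z ∈ X, η z = 0 ↔ θ z = 0) ∧ (dirDerivEnd K θ ^ numOff K X η) g = 0) ∨
      ∃ η' : Dual K U, (∀ z ∈ X, η z = 0 → η' z = 0) ∧ (∃ z ∈ X, η z ≠ 0 ∧ η' z = 0) ∧
        η' ≠ 0 ∧ spanIn K X η' ∉ S) :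
    g ∈ powKer K (powExp K 0 S X) := by
  have hle : ∀ η, powExp K 0 S X η ≤ numOff K X η + 1 := fun η => by
    rw [powExp]; split_ifs <;> omega
  intro η hη
  induction hm : numOff K X η using Nat.strong_induction_on generalizing η with
  | _ m ih =>
    subst hm
    have hpos := numOff_pos_iff.2 (exists_mem_ne_zero_of_spanAll_eq_top hX hη)
    by_cases hH : spanIn K X η = LinearMap.ker η
    · exact hhyp η hη hH
    by_cases hS : spanIn K X η ∈ S
    · obtain ⟨u, θ, hu, hθu, hθ⟩ := exists_dual_of_spanIn_ne_ker hH
      obtain ⟨s, -, hs⟩ := exists_generic X hθ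
      obtain ⟨T, hT, -, hsum⟩ := exists_pencil hs
      have ht0 : ∀ t ∈ T, η + t • (θ + s • η) ≠ 0 := by
        intro t ht h0
        have := LinearMap.congr_fun h0 u
        simp [hu, hθu, (hT t ht).1] at this
      -- A single special member would absorb the whole drop $m(\eta)$ and so vanish on $X$, which
      -- spans. Two members supply the slack $m(\eta)+2$ needed for $d=m(\eta)+1$.
      have hcard : 2 ≤ T.card := by
        by_contra hlt
        obtain h0 | h1 : T.card = 0 ∨ T.card = 1 := by omega
        · rw [Finset.card_eq_zero.1 h0, Finset.sum_empty] at hsum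
          omega
        · obtain ⟨t, rfl⟩ := Finset.card_eq_one.1 h1
          rw [Finset.sum_singleton] at hsum
          have h2 := numOff_pos_iff.2 (exists_mem_ne_zero_of_spanAll_eq_top hX
            (ht0 t (Finset.mem_singleton_self t)))
          omega
      have he : powExp K 0 S X η = numOff K X η + 1 := by
        rw [powExp, if_pos hS]; omega
      rw [he]
      refine pencil_apply' K (θ := θ + s • η) (T := T)
        (a := fun t => numOff K X (η + t • (θ + s • η)) + 1) (b := numOff K X η + 2)
        (fun t ht => pow_apply_eq_zero_of_le K (ih _ (hT t ht).2 _ (ht0 t ht) rfl) (hle _))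
        (fun hb => absurd hb (by omega)) ?_
      have h3 : ∑ t ∈ T, (numOff K X η + 1 + 1 - (numOff K X (η + t • (θ + s • η)) + 1)) =
          ∑ t ∈ T, ((numOff K X η - numOff K X (η + t • (θ + s • η))) + 1) :=
        Finset.sum_congr rfl fun t ht => by have := (hT t ht).2; omega
      rw [h3, Finset.sum_add_distrib, hsum]
      simpa using hcard
    have he : powExp K 0 S X η = numOff K X η := by
      rw [powExp, if_neg hS]; omega
    rw [he]
    rcases hmax η hη hS with ⟨θ, hθ, hθg⟩ | ⟨η', h1, ⟨z₀, hz₀, hz₀η, hz₀η'⟩, hη', hS'⟩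
    -- Here $\theta$ itself is killed with exponent $m(\eta)$, so $b=d=m(\eta)$ works and the drops
    -- suffice.
    · obtain ⟨T, hT, -, hsum⟩ := exists_pencil hθ
      by_cases ht0 : ∀ t ∈ T, η + t • θ ≠ 0
      · refine pencil_apply' K (T := T) (a := fun t => numOff K X (η + t • θ) + 1)
          (b := numOff K X η)
          (fun t ht => pow_apply_eq_zero_of_le K (ih _ (hT t ht).2 _ (ht0 t ht) rfl) (hle _))
          (fun _ => hθg) ?_
        refine hsum.ge.trans (Finset.sum_le_sum fun t ht => ?_)
        omega
      · push Not at ht0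
        obtain ⟨t, -, ht⟩ := ht0
        have : η = (-t) • θ := (eq_neg_of_add_eq_zero_left ht).trans (by module)
        rw [this, dirDerivEnd_smul_pow, LinearMap.smul_apply, ← this, hθg, smul_zero]
    -- The pencil is chosen to pass through $\eta'$, whose flat is missing too: there the exponent
    -- lacks $\chi$, which gains the one unit needed for $b=m(\eta)+1$.
    · obtain ⟨s, hs0, hs⟩ := exists_generic X h1
      obtain ⟨T, hT, hT', hsum⟩ := exists_pencil hs
      have ht0 : ∀ t ∈ T, η + t • (η' + s • η) ≠ 0 := by
        intro t ht h0
        have h2 : η' = (-(t⁻¹ * (1 + t * s))) • η := by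
          have ht := (hT t ht).1
          have h3 : t • η' = -((1 + t * s) • η) := by
            rw [eq_neg_iff_add_eq_zero, ← h0]
            module
          have h5 : (-(t⁻¹ * (1 + t * s))) • η = t⁻¹ • (-((1 + t * s) • η)) := by module
          rw [h5, ← h3, smul_smul, inv_mul_cancel₀ ht, one_smul]
        have h4 := LinearMap.congr_fun h2 z₀
        rw [hz₀η', LinearMap.smul_apply, smul_eq_mul, eq_comm, mul_eq_zero] at h4
        rw [h4.resolve_right hz₀η, zero_smul] at h2
        exact hη' h2
      have hθz₀ : (η' + s • η) z₀ = s * η z₀ := by simp [hz₀η']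
      have hmem := hT' z₀ hz₀ hz₀η
      rw [hθz₀] at hmem
      -- This is $-s^{-1}$, the parameter at which the pencil meets the line of $\eta'$; written
      -- this way it visibly belongs to `T`.
      set t₀ := -η z₀ / (s * η z₀) with ht₀
      have ht₀' : η + t₀ • (η' + s • η) = (-s⁻¹) • η' := by
        have : t₀ = -s⁻¹ := by rw [ht₀]; field_simp
        rw [this, smul_add, smul_smul, neg_mul, inv_mul_cancel₀ hs0]
        module
      refine pencil_apply' K (θ := η' + s • η) (T := T)
        (a := fun t => powExp K 0 S X (η + t • (η' + s • η))) (b := numOff K X η + 1)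
        (fun t ht => ih _ (hT t ht).2 _ (ht0 t ht) rfl)
        (fun hb => absurd hb (by omega)) ?_
      rw [Nat.add_one_le_iff]
      refine hsum.ge.trans_lt (Finset.sum_lt_sum (fun t ht => ?_) ⟨t₀, hmem, ?_⟩)
      · have := hle (η + t • (η' + s • η))
        omega
      · have h5 : spanIn K X (η + t₀ • (η' + s • η)) = spanIn K X η' :=
          spanIn_congr fun z _ => by rw [ht₀']; simp [hs0]
        have h6 : powExp K 0 S X (η + t₀ • (η' + s • η)) =
            numOff K X (η + t₀ • (η' + s • η)) := by
          rw [powExp, h5, if_neg hS']; omega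
        rw [h6]
        have := (hT t₀ hmem).2
        omega

end Flats

/-! ### Surjectivity for $k=-1$ and $J=\{X\}$. -/

section Internal

variable {K : Type*} [Field K] {U : Type*} [AddCommGroup U] [Module K U]

open Classical in
/-- The exponent that interpolates between the central case `W = ⊥` and the internal case
`W = ⊤`. -/
def semiExp (W : Submodule K U) (X : Multiset U) (η : Dual K U) : ℕ :=
  numOff K X η - if W ≤ LinearMap.ker η then 0 else 1

theorem semiExp_of_le {W : Submodule K U} {η : Dual K U} (h : W ≤ LinearMap.ker η)
    (X : Multiset U) : semiExp W X η = numOff K X η := by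
  rw [semiExp, if_pos h, Nat.sub_zero]

theorem semiExp_of_not_le {W : Submodule K U} {η : Dual K U} (h : ¬ W ≤ LinearMap.ker η)
    (X : Multiset U) : semiExp W X η = numOff K X η - 1 := by
  rw [semiExp, if_neg h]

theorem semiExp_anti {W W' : Submodule K U} (h : W ≤ W') (X : Multiset U) (η : Dual K U) :
    semiExp W' X η ≤ semiExp W X η := by
  rw [semiExp, semiExp]
  have := fun h' : W' ≤ LinearMap.ker η => h.trans h'
  split_ifs with h1 h2
  · exact le_rfl
  · exact absurd (this h1) h2
  · omega
  · exact le_rfl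

theorem semiExp_le_numOff (W : Submodule K U) (X : Multiset U) (η : Dual K U) :
    semiExp W X η ≤ numOff K X η := Nat.sub_le _ _

theorem semiExp_map (W : Submodule K U) (x : U) (X : Multiset U)
    (η : Dual K (U ⧸ Submodule.span K {x})) :
    semiExp (W.map (Submodule.span K {x}).mkQ) (X.map (Submodule.span K {x}).mkQ) η =
      semiExp W (x ::ₘ X) (η ∘ₗ (Submodule.span K {x}).mkQ) := by
  rw [semiExp, semiExp, numOff_map, numOff_cons_of_eq (comp_mkQ_apply_self η),
    Submodule.map_le_iff_le_comap, LinearMap.ker_comp]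

theorem powKer_congr {e e' : Dual K U → ℕ} (h : ∀ η, η ≠ 0 → e η = e' η) :
    powKer K e = powKer K e' :=
  le_antisymm (powKer_mono K fun η hη => (h η hη).le) (powKer_mono K fun η hη => (h η hη).ge)

theorem powKer_semiExp_bot (X : Multiset U) :
    powKer K (semiExp (⊥ : Submodule K U) X) = powKer K (powExp K (0 : ℕ) {⊤} X) := by
  refine powKer_congr fun η hη => ?_
  rw [semiExp_of_le bot_le, powExp_singleton_top _ _ hη]
  omega

theorem powKer_semiExp_top (X : Multiset U) :
    powKer K (semiExp (⊤ : Submodule K U) X) = powKer K (powExp K (-1) {⊤} X) := by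
  refine powKer_congr fun η hη => ?_
  rw [semiExp_of_not_le, powExp_singleton_top _ _ hη]
  · omega
  · rwa [top_le_iff, LinearMap.ker_eq_top]

/-- If $\eta$ vanished on all members of $X$ in $\ker\theta$, which span it, it would be a multiple
of $\theta$. -/
theorem numOffIn_pos_of_ne_smul {X : Multiset U} {η θ : Dual K U}
    (hθ : spanIn K X θ = LinearMap.ker θ) (hη : ∀ c : K, η ≠ c • θ) :
    0 < numOffIn X θ η := by
  rw [numOffIn_pos_iff]
  by_contra! h
  have h1 : LinearMap.ker θ ≤ LinearMap.ker η :=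
    hθ ▸ Submodule.span_le.2 fun z hz => h z hz.1 hz.2
  have h2 : η ∈ Submodule.span K (Set.range fun _ : Fin 1 => θ) :=
    mem_span_of_iInf_ker_le_ker (by simpa using h1)
  rw [Set.range_const, Submodule.mem_span_singleton] at h2
  obtain ⟨c, hc⟩ := h2
  exact hη c hc.symm

/-- The derivative $D_\theta^{m(\theta)-1}g$ satisfies the conditions of the vectors lying in
$\ker\theta$. In the pencil $\eta+t\theta$ the drops from the generic value $m(\theta)+n$, $n$ the
number of vectors in $\ker\theta$ off $\eta$, sum to $m(\theta)$; the mixed term with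
$j=m(\theta)-1$ is the claim. -/
theorem dirDerivEnd_pow_restrict [CharZero K] {X : Multiset U} (hX : spanAll K X = ⊤)
    {W : Submodule K U} {g : SymmetricAlgebra K U} (hg : g ∈ powKer K (semiExp W X))
    {η θ : Dual K U} (hθ0 : θ ≠ 0) (hθ : spanIn K X θ = LinearMap.ker θ)
    (hW : W ≤ LinearMap.ker θ) (hη : ∀ c : K, η ≠ c • θ) :
    (dirDerivEnd K η ^ (numOffIn X θ η - (numOff K X η - semiExp W X η)))
      ((dirDerivEnd K θ ^ (numOff K X θ - 1)) g) = 0 := by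
  have h0 := numOffIn_pos_of_ne_smul hθ hη
  have hθpos := numOff_pos_iff.2 (exists_mem_ne_zero_of_spanAll_eq_top hX hθ0)
  have hηpos : 0 < numOff K X η := by
    obtain ⟨z, hz, -, h⟩ := numOffIn_pos_iff.1 h0
    exact numOff_pos_iff.2 ⟨z, hz, h⟩
  obtain ⟨T, -, -, hle, hsum⟩ := exists_pencil_count X η θ
  -- Since $\theta$ vanishes on $W$, the correction in `semiExp` is the same for all members of the
  -- pencil.
  obtain ⟨ε, hε1, hε⟩ : ∃ ε ≤ 1, ∀ t : K, semiExp W X (η + t • θ) =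
      numOff K X (η + t • θ) - ε := by
    classical
    refine ⟨if W ≤ LinearMap.ker η then 0 else 1, by split_ifs <;> omega, fun t => ?_⟩
    have : W ≤ LinearMap.ker (η + t • θ) ↔ W ≤ LinearMap.ker η := by
      refine forall₂_congr fun w hw => ?_
      have : θ w = 0 := hW hw
      simp [this]
    rw [semiExp]
    congr 1
    simp only [this]
  have hε0 := hε 0
  rw [zero_smul, add_zero] at hε0
  have hεη : numOff K X η - semiExp W X η = ε := by omega
  have key := pencil_apply K (f := g) (η := η) (θ := θ) (T := T)
    (a := fun t => semiExp W X (η + t • θ))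
    (d := numOff K X θ + numOffIn X θ η - 1 - ε) (b := numOff K X θ) (j := numOff K X θ - 1)
    (fun t _ => hg _ fun h => hη (-t) ?_) (fun _ => ?_) ?_ (by omega)
  · rw [hεη]
    convert key using 3
    omega
  · exact (eq_neg_of_add_eq_zero_left h).trans (by module)
  · have := hg θ hθ0
    rwa [semiExp_of_le hW] at this
  · refine hsum.ge.trans (Finset.sum_le_sum fun t _ => ?_)
    rw [hε]
    have h1 := hle t
    have h2 : 0 < numOff K X (η + t • θ) := by
      obtain ⟨z, hz, hz1, hz2⟩ := numOffIn_pos_iff.1 h0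
      exact numOff_pos_iff.2 ⟨z, hz, by simpa [hz1] using hz2⟩
    omega

/-- A hyperplane normal scaled to be $1$ at $b$ is determined by the members of $X$ that it kills.
-/
theorem finite_normals (X : Multiset U) (b : U) :
    {θ : Dual K U | θ b = 1 ∧ spanIn K X θ = LinearMap.ker θ}.Finite := by
  classical
  refine Set.Finite.of_injOn (f := fun θ => X.filter fun z => θ z = 0)
    (t := (X.powerset.toFinset : Set (Multiset U))) ?_ ?_ (Finset.finite_toSet _)
  · intro θ _
    simp
  · rintro η ⟨hηb, hη⟩ θ ⟨hθb, hθ⟩ h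
    have h1 : spanIn K X η = spanIn K X θ := by
      refine spanIn_congr fun z hz => ?_
      have := congrArg (fun s => z ∈ s) h
      simpa [hz] using this
    rw [hη, hθ] at h1
    ext u
    have h2 : u - η u • b ∈ LinearMap.ker η := by simp [hηb]
    rw [h1, LinearMap.mem_ker, map_sub, map_smul, hθb, smul_eq_mul, mul_one, sub_eq_zero] at h2
    exact h2.symm

open Classical in
/-- The correction term for the hyperplane `θ = 0`. -/
def corrTerm (X : Multiset U) (θ : Dual K U) (g : SymmetricAlgebra K U) : SymmetricAlgebra K U :=
  (dirDerivEnd K θ ^ numOff K X θ) g *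
    ((X.filter fun z => θ z ≠ 0).map (SymmetricAlgebra.ι K U)).prod

open Classical in
theorem numOff_eq_add (X : Multiset U) (η θ : Dual K U) :
    numOff K X η = numOffIn X θ η + ((X.filter fun z => θ z ≠ 0).filter fun z => η z ≠ 0).card := by
  induction X using Multiset.induction with
  | empty => simp [numOff_zero, numOffIn]
  | cons y Y ih =>
    by_cases hθ : θ y = 0
    · rw [Multiset.filter_cons_of_neg (p := fun z => θ z ≠ 0) _ (by simpa using hθ)]
      by_cases hη : η y = 0
      · rw [numOff_cons_of_eq hη, numOffIn_cons_of_eq hη, ih]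
      · rw [numOff_cons_of_ne hη, numOffIn_cons hθ hη]
        omega
    · rw [Multiset.filter_cons_of_pos (p := fun z => θ z ≠ 0) _ hθ, numOffIn_cons_of_ne hθ]
      by_cases hη : η y = 0
      · rw [numOff_cons_of_eq hη,
          Multiset.filter_cons_of_neg (p := fun z => η z ≠ 0) _ (by simpa using hη), ih]
      · rw [numOff_cons_of_ne hη, Multiset.filter_cons_of_pos (p := fun z => η z ≠ 0) _ hη,
          Multiset.card_cons]
        omega

/-- Add the order of $D_\theta^{m(\theta)-1}g$ from `dirDerivEnd_pow_restrict` to the number of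
factors off $\eta$. The vector $b$ is not a factor, and this saves one derivative when
$\eta(b)\ne0$. -/
theorem dirDerivEnd_pow_corrTerm_eq_zero [CharZero K] {X : Multiset U} {b : U}
    (hX : spanAll K (b ::ₘ X) = ⊤) {W : Submodule K U} {g : SymmetricAlgebra K U}
    (hg : g ∈ powKer K (semiExp W (b ::ₘ X)))
    {η θ : Dual K U} (hθb : θ b ≠ 0) (hθ : spanIn K (b ::ₘ X) θ = LinearMap.ker θ)
    (hW : W ≤ LinearMap.ker θ) (hη : ∀ c : K, η ≠ c • θ) :
    (dirDerivEnd K η ^ semiExp (W ⊔ Submodule.span K {b}) (b ::ₘ X) η) (corrTerm X θ g) = 0 := by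
  classical
  have hθ0 : θ ≠ 0 := by rintro rfl; exact hθb rfl
  have h0 := numOffIn_pos_of_ne_smul hθ hη
  have h1 := dirDerivEnd_pow_restrict hX hg hθ0 hθ hW hη
  rw [numOff_cons_of_ne hθb, Nat.add_sub_cancel] at h1
  have h2 := dirDerivEnd_pow_mul_eq_zero K η h1
    (dirDerivEnd_pow_prod_eq_zero K η (X.filter fun z => θ z ≠ 0))
  refine pow_apply_eq_zero_of_le K h2 ?_
  rw [numOffIn_cons_of_ne hθb] at h0 ⊢
  have h3 := numOff_eq_add X η θ
  have hle : W ⊔ Submodule.span K {b} ≤ LinearMap.ker η ↔ W ≤ LinearMap.ker η ∧ η b = 0 := by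
    rw [sup_le_iff, Submodule.span_singleton_le_iff_mem, LinearMap.mem_ker]
  rw [semiExp, semiExp]
  by_cases hb : η b = 0
  · rw [numOff_cons_of_eq hb]
    by_cases hWη : W ≤ LinearMap.ker η
    · rw [if_pos hWη, if_pos (hle.2 ⟨hWη, hb⟩)]
      omega
    · rw [if_neg hWη, if_neg (fun h => hWη (hle.1 h).1)]
      omega
  · rw [numOff_cons_of_ne hb, if_neg (fun h => hb (hle.1 h).2)]
    split_ifs <;> omega

open Classical in
theorem card_filter_ne (X : Multiset U) (θ : Dual K U) :
    (X.filter fun z => θ z ≠ 0).card = numOff K X θ :=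
  (Multiset.countP_eq_card_filter _ _).symm

/-- The first factor is a constant for $D_\theta$, so only the product is differentiated; it gives a
factorial times the non-zero values $\theta(z)$. -/
theorem dirDerivEnd_pow_corrTerm [CharZero K] {X : Multiset U} {θ : Dual K U}
    {g : SymmetricAlgebra K U} (hg : (dirDerivEnd K θ ^ (numOff K X θ + 1)) g = 0) :
    ∃ c : K, c ≠ 0 ∧ (dirDerivEnd K θ ^ numOff K X θ) (corrTerm X θ g) =
      c • (dirDerivEnd K θ ^ numOff K X θ) g := by
  classical
  refine ⟨(numOff K X θ).factorial * ((X.filter fun z => θ z ≠ 0).map θ).prod, ?_, ?_⟩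
  · refine mul_ne_zero (by exact_mod_cast Nat.factorial_ne_zero _) (Multiset.prod_ne_zero ?_)
    simp
  · rw [corrTerm, dirDerivEnd_pow_mul_of_eq_zero K (by rwa [← pow_succ_apply]),
      ← card_filter_ne X θ, dirDerivEnd_pow_prod, Algebra.smul_def, mul_comm]

theorem dirDerivEnd_pow_succ_corrTerm {X : Multiset U} {θ : Dual K U}
    {g : SymmetricAlgebra K U} (hg : (dirDerivEnd K θ ^ (numOff K X θ + 1)) g = 0) :
    (dirDerivEnd K θ ^ (numOff K X θ + 1)) (corrTerm X θ g) = 0 := by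
  classical
  rw [corrTerm, dirDerivEnd_pow_mul_of_eq_zero K (by rwa [← pow_succ_apply])]
  have := dirDerivEnd_pow_prod_succ K θ (X.filter fun z => θ z ≠ 0)
  rw [card_filter_ne] at this
  rw [this, mul_zero]

/-- If $\theta(x)\ne0$, then $p_x$ is one of the factors; otherwise the first factor has image zero.
-/
theorem symMap_corrTerm {X : Multiset U} {θ : Dual K U} {g : SymmetricAlgebra K U} {x : U}
    (hx : x ∈ X) (h : θ x = 0 →
      symMap K (Submodule.span K {x}).mkQ ((dirDerivEnd K θ ^ numOff K X θ) g) = 0) :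
    symMap K (Submodule.span K {x}).mkQ (corrTerm X θ g) = 0 := by
  classical
  rw [corrTerm, map_mul]
  by_cases hθ : θ x = 0
  · rw [h hθ, zero_mul]
  · rw [symMap_prod]
    refine mul_eq_zero_of_right _ (Multiset.prod_eq_zero ?_)
    rw [Multiset.map_map]
    have hx0 : (Submodule.span K {x}).mkQ x = 0 := by simp
    exact Multiset.mem_map.2 ⟨x, Multiset.mem_filter.2 ⟨hx, hθ⟩, by
      rw [Function.comp_apply, hx0, map_zero]⟩

/-- Only hyperplanes that contain $W$ but not $b$ impose a new condition,
$D_\theta^{m(\theta)-1}g=0$. A suitable multiple of its correction term achieves this for each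
$\theta$ without disturbing the other conditions or the image over $U/x$. -/
theorem exists_mem_powKer_semiExp_sup [CharZero K] {X : Multiset U} {b x : U}
    (hX : spanAll K (b ::ₘ X) = ⊤) (hx : x ∈ X) {W : Submodule K U} {g : SymmetricAlgebra K U}
    (hg : g ∈ powKer K (semiExp W (b ::ₘ X)))
    (hgx : ∀ θ : Dual K U, θ x = 0 → θ b ≠ 0 →
      symMap K (Submodule.span K {x}).mkQ ((dirDerivEnd K θ ^ numOff K X θ) g) = 0) :
    ∃ g' ∈ powKer K (semiExp (W ⊔ Submodule.span K {b}) (b ::ₘ X)),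
      symMap K (Submodule.span K {x}).mkQ g' = symMap K (Submodule.span K {x}).mkQ g := by
  classical
  -- Scaling by $\theta(b)=1$ gives one normal for each hyperplane to be corrected, so the sum below
  -- is finite and has no repetitions.
  have hfin : {θ : Dual K U | (θ b = 1 ∧ spanIn K (b ::ₘ X) θ = LinearMap.ker θ) ∧
      W ≤ LinearMap.ker θ}.Finite := (finite_normals (b ::ₘ X) b).subset fun _ h => h.1
  have hH : ∀ θ ∈ hfin.toFinset, θ b ≠ 0 ∧ θ ≠ 0 ∧ θ b = 1 ∧
      spanIn K (b ::ₘ X) θ = LinearMap.ker θ ∧ W ≤ LinearMap.ker θ := by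
    intro θ hθ
    obtain ⟨⟨h1, h2⟩, h3⟩ := hfin.mem_toFinset.1 hθ
    have h4 : θ b ≠ 0 := by rw [h1]; exact one_ne_zero
    exact ⟨h4, by rintro rfl; exact h4 rfl, h1, h2, h3⟩
  have hkill : ∀ θ ∈ hfin.toFinset, (dirDerivEnd K θ ^ (numOff K X θ + 1)) g = 0 := by
    intro θ hθ
    obtain ⟨h1, h2, -, -, h3⟩ := hH θ hθ
    have := hg θ h2
    rwa [semiExp_of_le h3, numOff_cons_of_ne h1] at this
  have hc : ∀ θ : Dual K U, ∃ c : K, θ ∈ hfin.toFinset → c ≠ 0 ∧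
      (dirDerivEnd K θ ^ numOff K X θ) (corrTerm X θ g) =
        c • (dirDerivEnd K θ ^ numOff K X θ) g := by
    intro θ
    by_cases hθ : θ ∈ hfin.toFinset
    · obtain ⟨c, h⟩ := dirDerivEnd_pow_corrTerm (hkill θ hθ)
      exact ⟨c, fun _ => h⟩
    · exact ⟨0, fun h => absurd h hθ⟩
  choose c hc using hc
  have hprop : ∀ θ ∈ hfin.toFinset, ∀ θ' ∈ hfin.toFinset, ∀ a d : K, a ≠ 0 → a • θ = d • θ' →
      θ = θ' := by
    intro θ hθ θ' hθ' a d ha h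
    have h1 := LinearMap.congr_fun h b
    rw [LinearMap.smul_apply, LinearMap.smul_apply, (hH θ hθ).2.2.1, (hH θ' hθ').2.2.1,
      smul_eq_mul, smul_eq_mul, mul_one, mul_one] at h1
    rw [← h1] at h
    exact smul_right_injective _ ha h
  have hcorr : ∀ θ ∈ hfin.toFinset, corrTerm X θ g ∈ powKer K (semiExp W (b ::ₘ X)) := by
    intro θ hθ η hη
    obtain ⟨h1, h2, h3, h4, h5⟩ := hH θ hθ
    by_cases h : ∃ d : K, η = d • θ
    · obtain ⟨d, rfl⟩ := h
      have hW : W ≤ LinearMap.ker (d • θ) := fun w hw => by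
        have : θ w = 0 := h5 hw
        simp [this]
      have hd : d ≠ 0 := by rintro rfl; exact hη (zero_smul _ _)
      rw [semiExp_of_le hW, numOff_congr (θ := θ) fun z _ => by simp [hd],
        numOff_cons_of_ne h1, dirDerivEnd_smul_pow, LinearMap.smul_apply,
        dirDerivEnd_pow_succ_corrTerm (hkill θ hθ), smul_zero]
    · push Not at h
      exact pow_apply_eq_zero_of_le K (dirDerivEnd_pow_corrTerm_eq_zero hX hg h1 h4 h5 h)
        (semiExp_anti le_sup_left _ _)
  let g' := g - ∑ θ ∈ hfin.toFinset, (c θ)⁻¹ • corrTerm X θ g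
  have hg' : g' ∈ powKer K (semiExp W (b ::ₘ X)) :=
    sub_mem hg (Submodule.sum_mem _ fun θ hθ => Submodule.smul_mem _ _ (hcorr θ hθ))
  refine ⟨g', fun η hη => ?_, ?_⟩
  · have hle : W ⊔ Submodule.span K {b} ≤ LinearMap.ker η ↔ W ≤ LinearMap.ker η ∧ η b = 0 := by
      rw [sup_le_iff, Submodule.span_singleton_le_iff_mem, LinearMap.mem_ker]
    by_cases h1 : W ≤ LinearMap.ker η
    swap
    · rw [semiExp_of_not_le fun h => h1 (hle.1 h).1, ← semiExp_of_not_le h1]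
      exact hg' η hη
    by_cases h2 : η b = 0
    · rw [semiExp_of_le (hle.2 ⟨h1, h2⟩), ← semiExp_of_le h1]
      exact hg' η hη
    rw [semiExp_of_not_le fun h => h2 (hle.1 h).2]
    -- At flats that are not hyperplanes the exponent $m(\eta)-1$ is automatic.
    by_cases h3 : spanIn K (b ::ₘ X) η = LinearMap.ker η
    swap
    · exact dirDerivEnd_pow_pred_of_hyperplanes hX (fun θ hθ _ =>
        pow_apply_eq_zero_of_le K (hg' θ hθ) (semiExp_le_numOff _ _ _)) hη h3
    obtain ⟨θ, hθη⟩ : ∃ θ, η = η b • θ := ⟨(η b)⁻¹ • η, by rw [smul_smul, mul_inv_cancel₀ h2, one_smul]⟩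
    have hz : ∀ z, η z = 0 ↔ θ z = 0 := fun z => by
      rw [hθη]
      simp [h2]
    have hker : LinearMap.ker η = LinearMap.ker θ := by ext z; exact hz z
    have hθ : θ ∈ hfin.toFinset := by
      rw [hfin.mem_toFinset]
      refine ⟨⟨?_, ?_⟩, ?_⟩
      · have := LinearMap.congr_fun hθη b
        rw [LinearMap.smul_apply, smul_eq_mul] at this
        exact (mul_right_eq_self₀.1 this.symm).resolve_right h2
      · rw [← hker, ← h3]
        exact spanIn_congr fun z _ => (hz z).symm
      · rwa [← hker]
    rw [numOff_congr fun z _ => hz z, numOff_cons_of_ne (hH θ hθ).1, Nat.add_sub_cancel, hθη,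
      dirDerivEnd_smul_pow, LinearMap.smul_apply]
    rw [map_sub, map_sum, Finset.sum_eq_single_of_mem θ hθ, map_smul, (hc θ hθ).2, smul_smul,
      inv_mul_cancel₀ (hc θ hθ).1, one_smul, sub_self, smul_zero]
    -- The correction terms of the other hyperplanes already satisfy the new condition at $\theta$.
    intro θ' hθ' hne
    rw [map_smul]
    have h4 : ∀ d : K, θ ≠ d • θ' := fun d hd =>
      hne (hprop θ hθ θ' hθ' 1 d one_ne_zero (by rwa [one_smul])).symm
    have h5 := dirDerivEnd_pow_corrTerm_eq_zero hX hg (hH θ' hθ').1 (hH θ' hθ').2.2.2.1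
      (hH θ' hθ').2.2.2.2 h4
    rw [semiExp_of_not_le fun h => (hH θ hθ).1 (h (Submodule.mem_sup_right
      (Submodule.mem_span_singleton_self b))), numOff_cons_of_ne (hH θ hθ).1,
      Nat.add_sub_cancel] at h5
    rw [h5, smul_zero]
  · rw [map_sub, map_sum, Finset.sum_eq_zero, sub_zero]
    intro θ hθ
    rw [map_smul, symMap_corrTerm hx fun h => hgx θ h (hH θ hθ).1, smul_zero]

/-- Induction on the generators of $W$. The empty set is the case $k=0$, $J=\{X\}$. When $b$ is
adjoined, the condition on $h$ at each $\theta$ with $\theta(x)=0$, $\theta(b)\ne0$ is exactly what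
makes the correction terms vanish over $U/x$. -/
theorem exists_lift_semiExp [CharZero K] [FiniteDimensional K U] {x : U} {X : Multiset U}
    (hX : spanAll K (x ::ₘ X) = ⊤) (s : Finset U) (hs : ∀ b ∈ s, b ∈ X) :
    ∀ h ∈ powKer K (semiExp ((Submodule.span K (s : Set U)).map (Submodule.span K {x}).mkQ)
        (X.map (Submodule.span K {x}).mkQ)),
      ∃ g ∈ powKer K (semiExp (Submodule.span K (s : Set U)) (x ::ₘ X)),
        symMap K (Submodule.span K {x}).mkQ g = h := by
  classical
  induction s using Finset.induction_on with
  | empty =>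
    intro h hh
    have hU : IsUpperSet ({⊤} : Set (Submodule K U)) := fun a b hab ha => by
      rw [Set.mem_singleton_iff] at ha ⊢
      rw [ha] at hab
      exact top_le_iff.1 hab
    rw [Finset.coe_empty, Submodule.span_empty, Submodule.map_bot, powKer_semiExp_bot,
      ← quotUpper_singleton_top x] at hh
    rw [Finset.coe_empty, Submodule.span_empty, powKer_semiExp_bot]
    exact exists_lift_of_mem_powKer 0 hU (Set.mem_singleton _) x X hh
  | insert b s _ ih =>
    intro h hh
    have hspan : Submodule.span K ((insert b s : Finset U) : Set U) =
        Submodule.span K (s : Set U) ⊔ Submodule.span K {b} := by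
      rw [Finset.coe_insert, Submodule.span_insert, sup_comm]
    rw [hspan] at hh ⊢
    obtain ⟨g, hg, rfl⟩ := ih (fun c hc => hs c (Finset.mem_insert_of_mem hc)) h
      (powKer_mono K (fun η _ => semiExp_anti (Submodule.map_mono le_sup_left) _ _) hh)
    obtain ⟨X, rfl⟩ := Multiset.exists_cons_of_mem (hs b (Finset.mem_insert_self _ _))
    rw [Multiset.cons_swap] at hX hg ⊢
    refine exists_mem_powKer_semiExp_sup hX (Multiset.mem_cons_self _ _) hg fun θ hθx hθb => ?_
    let θ' : Dual K (U ⧸ Submodule.span K {x}) := (Submodule.span K {x}).liftQ θ (by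
      rwa [Submodule.span_singleton_le_iff_mem, LinearMap.mem_ker])
    have hθ' : θ = θ' ∘ₗ (Submodule.span K {x}).mkQ := by
      ext u; rfl
    have hθ'0 : θ' ≠ 0 := by
      intro h0
      rw [hθ', h0] at hθb
      exact hθb rfl
    have h1 := hh θ' hθ'0
    rw [semiExp_map, ← hθ', semiExp_of_not_le fun h => hθb (h (Submodule.mem_sup_right
      (Submodule.mem_span_singleton_self b))), Multiset.cons_swap, numOff_cons_of_ne hθb,
      Nat.add_sub_cancel, ← symMap_dirDerivEnd_pow, ← hθ'] at h1
    exact h1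

theorem exists_lift_internal [CharZero K] [FiniteDimensional K U] {x : U} {X : Multiset U}
    (hX : spanAll K X = ⊤) {h : SymmetricAlgebra K (U ⧸ Submodule.span K {x})}
    (hh : h ∈ powKer K (powExp K (-1) {⊤} (X.map (Submodule.span K {x}).mkQ))) :
    ∃ g ∈ powKer K (powExp K (-1) {⊤} (x ::ₘ X)),
      symMap K (Submodule.span K {x}).mkQ g = h := by
  classical
  have hs : Submodule.span K (X.toFinset : Set U) = ⊤ := by
    rw [← hX, spanAll]
    congr 1
    ext z
    simp
  have h1 := exists_lift_semiExp (x := x) (X := X) (by rw [spanAll_cons, hX, top_sup_eq])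
    X.toFinset (fun b hb => by simpa using hb) h
  rw [hs, Submodule.map_top, Submodule.range_mkQ, powKer_semiExp_top, powKer_semiExp_top] at h1
  exact h1 hh

end Internal

/-! ### Finite families as multisets. -/

section FiniteFamilies

variable {A : Type*} {ι : Type*}

/-- The multiset of members of a finite family. -/
def famMultiset [Finite ι] (X : ι → A) : Multiset A :=
  letI := Fintype.ofFinite ι
  (Finset.univ : Finset ι).val.map X

theorem mem_famMultiset [Finite ι] {X : ι → A} {z : A} : z ∈ famMultiset X ↔ ∃ j, X j = z := by
  simp [famMultiset]

theorem famMultiset_eq_cons [Finite ι] (X : ι → A) (i : ι) :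
    famMultiset X = X i ::ₘ famMultiset (deletion X i) := by
  classical
  let _ := Fintype.ofFinite ι
  have h : (Finset.univ : Finset {j // j ≠ i}).map (Function.Embedding.subtype _) =
      Finset.univ.erase i := by
    ext j
    simp
  have h1 : famMultiset (deletion X i) = ((Finset.univ : Finset ι).erase i).val.map X := by
    rw [← h, Finset.map_val, Multiset.map_map, famMultiset]
    congr!
  rw [h1, ← Multiset.map_cons, Finset.erase_val, Multiset.cons_erase (Finset.mem_univ_val i)]
  rfl

end FiniteFamilies

/-! ### From flats to subspaces, and the two ideals. -/

section Families

variable {K : Type*} [Field K] {U : Type*} [AddCommGroup U] [Module K U] {ι : Type*}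

theorem spanAll_famMultiset [Finite ι] (X : ι → U) :
    spanAll K (famMultiset X) = Submodule.span K (Set.range X) := by
  rw [spanAll]
  congr 1
  ext z
  exact mem_famMultiset

theorem spanIn_famMultiset [Finite ι] (X : ι → U) (η : Dual K U) :
    spanIn K (famMultiset X) η = Submodule.span K (X '' flatOf K X η) := by
  rw [spanIn]
  refine congrArg (Submodule.span K) (Set.ext fun z => ?_)
  constructor
  · rintro ⟨h1, h2⟩
    obtain ⟨j, rfl⟩ := mem_famMultiset.1 h1
    exact ⟨j, h2, rfl⟩
  · rintro ⟨j, hj, rfl⟩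
    exact ⟨mem_famMultiset.2 ⟨j, rfl⟩, hj⟩

theorem numOff_famMultiset [Finite ι] (X : ι → U) (η : Dual K U) :
    numOff K (famMultiset X) η = (flatOf K X η)ᶜ.ncard := by
  classical
  let _ := Fintype.ofFinite ι
  have h : (flatOf K X η)ᶜ = ((Finset.univ.filter fun j => η (X j) ≠ 0 : Finset ι) : Set ι) := by
    ext j
    simp [flatOf]
  rw [numOff, famMultiset, Multiset.countP_map, h, Set.ncard_coe_finset]
  rfl

theorem famMultiset_contraction [Finite ι] (X : ι → U) (i : ι) :
    famMultiset (contraction K X i) =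
      (famMultiset (deletion X i)).map (Submodule.span K {X i}).mkQ := by
  rw [famMultiset, famMultiset, Multiset.map_map]
  rfl

variable (K) in
/-- The set `J` of flats is described by the set `S` of subspaces. -/
def Describes (X : ι → U) (J : Set (Set ι)) (S : Set (Submodule K U)) : Prop :=
  ∀ η : Dual K U, flatOf K X η ∈ J ↔ Submodule.span K (X '' flatOf K X η) ∈ S

theorem exponent_flatOf [Finite ι] {X : ι → U} {J : Set (Set ι)} {S : Set (Submodule K U)}
    (h : Describes K X J S) (k : ℤ) (η : Dual K U) :
    exponent k J (flatOf K X η) = powExp K k S (famMultiset X) η := by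
  classical
  rw [exponent, powExp, numOff_famMultiset, spanIn_famMultiset]
  simp only [h η]

theorem ker_hierIdeal [CharZero K] [FiniteDimensional K U] [Finite ι] {X : ι → U}
    {J : Set (Set ι)} {S : Set (Submodule K U)} (h : Describes K X J S) (k : ℤ) :
    ker K (hierIdeal K X k J) = powKer K (powExp K k S (famMultiset X)) := by
  ext f
  rw [mem_ker_iff, hierIdeal, Ideal.span_le]
  constructor
  · intro hf η hη
    rw [← exponent_flatOf h]
    exact (ι_pow_mem_annIdeal K).1 (hf ⟨η, hη, rfl⟩)
  · rintro hf _ ⟨η, hη, rfl⟩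
    rw [exponent_flatOf h]
    exact (ι_pow_mem_annIdeal K).2 (hf η hη)

theorem span_image_preimage_le (X : ι → U) (W : Submodule K U) :
    Submodule.span K (X '' (X ⁻¹' (W : Set U))) ≤ W :=
  Submodule.span_le.2 (Set.image_preimage_subset X W)

theorem flatOf_zero (X : ι → U) : flatOf K X 0 = Set.univ := by
  ext j
  simp [flatOf]

section Closure

variable [FiniteDimensional K U]

theorem mem_clos {X : ι → U} {Y : Set ι} {j : ι} :
    j ∈ clos K X Y ↔ X j ∈ Submodule.span K (X '' Y) := by
  have h : Submodule.span K (X '' insert j Y) =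
      Submodule.span K {X j} ⊔ Submodule.span K (X '' Y) := by
    rw [Set.image_insert_eq, Submodule.span_insert]
  change rank K X (insert j Y) = rank K X Y ↔ _
  rw [rank, rank, h, ← Submodule.span_singleton_le_iff_mem]
  constructor
  · intro h1
    have := Submodule.eq_of_le_of_finrank_eq (le_sup_right :
      Submodule.span K (X '' Y) ≤ Submodule.span K {X j} ⊔ Submodule.span K (X '' Y)) h1.symm
    rw [this]
    exact le_sup_left
  · intro h1
    rw [sup_eq_right.2 h1]

theorem isFlat_iff {X : ι → U} {C : Set ι} :
    IsFlat K X C ↔ ∀ j, X j ∈ Submodule.span K (X '' C) → j ∈ C := by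
  constructor
  · intro h j hj
    rw [← h, mem_clos]
    exact hj
  · intro h
    ext j
    rw [mem_clos]
    exact ⟨h j, fun hj => Submodule.subset_span ⟨j, hj, rfl⟩⟩

theorem isFlat_preimage (X : ι → U) (W : Submodule K U) : IsFlat K X (X ⁻¹' (W : Set U)) :=
  isFlat_iff.2 fun _ hj => span_image_preimage_le X W hj

theorem isFlat_flatOf (X : ι → U) (η : Dual K U) : IsFlat K X (flatOf K X η) :=
  isFlat_preimage X (LinearMap.ker η)

theorem preimage_span_flatOf (X : ι → U) (η : Dual K U) :
    X ⁻¹' (Submodule.span K (X '' flatOf K X η) : Set U) = flatOf K X η := by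
  ext j
  constructor
  · exact fun hj => isFlat_iff.1 (isFlat_flatOf X η) j hj
  · exact fun hj => Submodule.subset_span ⟨j, hj, rfl⟩

/-- The subspaces whose members in `X` form a flat in `J`. -/
def upperOf (K : Type*) [Field K] {U : Type*} [AddCommGroup U] [Module K U] (X : ι → U)
    (J : Set (Set ι)) : Set (Submodule K U) :=
  {W | X ⁻¹' (W : Set U) ∈ J}

theorem isUpperSet_upperOf {X : ι → U} {J : Set (Set ι)} (hJ : IsUpperSetOfFlats K X J) :
    IsUpperSet (upperOf K X J) :=
  fun _ W' h hW => hJ.upward _ hW _ (isFlat_preimage X W') (Set.preimage_mono h)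

theorem top_mem_upperOf {X : ι → U} {J : Set (Set ι)} (hJ : IsUpperSetOfFlats K X J) :
    ⊤ ∈ upperOf K X J := by
  obtain ⟨C, hC⟩ := hJ.nonempty
  exact hJ.upward C hC _ (isFlat_preimage X ⊤) fun _ _ => trivial

theorem describes_upperOf (X : ι → U) (J : Set (Set ι)) : Describes K X J (upperOf K X J) := by
  intro η
  rw [upperOf, Set.mem_ofPred_eq, preimage_span_flatOf]

/-- The same set of subspaces serves for $X$ and $X\setminus x$: a flat of the deletion belongs to
$J\setminus x$ exactly when the $X$-closure of its span belongs to $J$. -/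
theorem describes_deletion (X : ι → U) (J : Set (Set ι)) (i : ι) :
    Describes K (deletion X i) (delUpper K X J i) (upperOf K X J) := by
  intro η
  have himg : deletion X i '' flatOf K (deletion X i) η = X '' (flatOf K X η \ {i}) := by
    ext z
    constructor
    · rintro ⟨⟨j, hj⟩, h, rfl⟩
      exact ⟨j, ⟨h, hj⟩, rfl⟩
    · rintro ⟨j, ⟨h, hj⟩, rfl⟩
      exact ⟨⟨j, hj⟩, h, rfl⟩
  have hsub : ∀ C : Set ι, Subtype.val ⁻¹' C = flatOf K (deletion X i) η →
      C \ {i} = flatOf K X η \ {i} := by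
    intro C hC
    ext j
    refine and_congr_left fun hj => ?_
    exact Set.ext_iff.1 hC ⟨j, hj⟩
  have hclos : ∀ Y : Set ι, clos K X Y = X ⁻¹' (Submodule.span K (X '' Y) : Set U) :=
    fun Y => Set.ext fun j => mem_clos
  rw [himg]
  constructor
  · rintro ⟨C, hC, hC', h⟩
    rw [hsub C h.symm, hclos] at hC'
    rw [upperOf, Set.mem_ofPred_eq, ← hC']
    exact hC
  · intro h
    have hD : Subtype.val ⁻¹' (X ⁻¹' (Submodule.span K (X '' (flatOf K X η \ {i})) : Set U)) =
        flatOf K (deletion X i) η := by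
      ext ⟨j, hj⟩
      constructor
      · intro h1
        have h2 : X '' (flatOf K X η \ {i}) ⊆ (LinearMap.ker η : Set U) := by
          rintro _ ⟨l, hl, rfl⟩
          exact hl.1
        exact Submodule.span_le.2 h2 h1
      · intro h1
        exact Submodule.subset_span ⟨j, ⟨h1, hj⟩, rfl⟩
    refine ⟨_, h, ?_, hD.symm⟩
    rw [hsub _ hD, hclos]

theorem describes_contraction [Finite ι] (X : ι → U) (J : Set (Set ι)) (i : ι) :
    Describes K (contraction K X i) (contrUpper J i) (quotUpper (upperOf K X J) (X i)) := by
  intro η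
  have hi : i ∈ flatOf K X (η ∘ₗ (Submodule.span K {X i}).mkQ) := comp_mkQ_apply_self η
  have h1 : Submodule.span K (contraction K X i '' flatOf K (contraction K X i) η) ∈
      quotUpper (upperOf K X J) (X i) ↔
      flatOf K X (η ∘ₗ (Submodule.span K {X i}).mkQ) ∈ J := by
    rw [← spanIn_famMultiset, quotUpper, Set.mem_ofPred_eq, famMultiset_contraction,
      comap_spanIn_map, ← famMultiset_eq_cons, spanIn_famMultiset, ← describes_upperOf]
  have h2 : Subtype.val ⁻¹' flatOf K X (η ∘ₗ (Submodule.span K {X i}).mkQ) =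
      flatOf K (contraction K X i) η := rfl
  rw [h1]
  constructor
  · rintro ⟨C, hC, hiC, h⟩
    have : C = flatOf K X (η ∘ₗ (Submodule.span K {X i}).mkQ) := by
      ext j
      by_cases hj : j = i
      · subst hj
        exact iff_of_true hiC hi
      · rw [h] at h2
        exact (Set.ext_iff.1 h2 ⟨j, hj⟩).symm
    rwa [← this]
  · intro h
    exact ⟨_, h, hi, h2.symm⟩

theorem isHyperplane_flatOf {X : ι → U} {η : Dual K U} (hη : η ≠ 0)
    (h : Submodule.span K (X '' flatOf K X η) = LinearMap.ker η) :
    IsHyperplane K X (flatOf K X η) := by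
  refine ⟨isFlat_flatOf X η, ?_⟩
  rw [rank, h]
  exact Module.Dual.finrank_ker_add_one_of_ne_zero hη

/-- The choice of normals does not matter: a hyperplane normal is unique up to scalars, and at a
maximal missing flat any one normal serves as the $\theta$ in `mem_powKer_zero_of`. A missing flat
that is not maximal lies in a larger one, whose normal is the $\eta'$ there. -/
theorem ker_hierIdeal' [CharZero K] [Finite ι] {X : ι → U}
    (hX : Submodule.span K (Set.range X) = ⊤) {J : Set (Set ι)} {S : Set (Submodule K U)}
    (hS : ⊤ ∈ S) (h : Describes K X J S) {k : ℤ} (hk : k = -1 ∨ k = 0)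
    {E : Set ι → Dual K U} (hE : IsNormalSelector K X E) :
    ker K (hierIdeal' K X k J E) = powKer K (powExp K k S (famMultiset X)) := by
  have hX' : spanAll K (famMultiset X) = ⊤ := by rw [spanAll_famMultiset, hX]
  have huniv : Set.univ ∈ J := by
    have := h 0
    rw [flatOf_zero, Set.image_univ, hX] at this
    exact this.2 hS
  ext f
  rw [mem_ker_iff, hierIdeal', Ideal.span_le]
  constructor
  · intro hf
    have hf' : ∀ C, IsHyperplane K X C ∨ IsMaximalMissingFlat K X J C →
        (dirDerivEnd K (E C) ^ exponent k J C) f = 0 :=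
      fun C hC => (ι_pow_mem_annIdeal K).1 (hf ⟨C, hC, rfl⟩)
    have hhyp : ∀ η : Dual K U, η ≠ 0 → spanIn K (famMultiset X) η = LinearMap.ker η →
        (dirDerivEnd K η ^ powExp K k S (famMultiset X) η) f = 0 := by
      intro η hη hH
      rw [← exponent_flatOf h]
      have hC := isHyperplane_flatOf hη ((spanIn_famMultiset X η).symm.trans hH)
      have hEC := hE _ hC.1
      obtain ⟨c, hc⟩ : ∃ c : K, E (flatOf K X η) = c • η := by
        by_contra! hne
        obtain ⟨z, hz, h1, h2⟩ := numOffIn_pos_iff.1 (numOffIn_pos_of_ne_smul hH hne)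
        obtain ⟨j, rfl⟩ := mem_famMultiset.1 hz
        have h3 : j ∈ flatOf K X (E (flatOf K X η)) := by rw [hEC]; exact h1
        exact h2 h3
      have hc0 : c ≠ 0 := by
        rintro rfl
        rw [zero_smul] at hc
        rw [hc, flatOf_zero] at hEC
        obtain ⟨z, hz, hne⟩ := exists_mem_ne_zero_of_spanAll_eq_top hX' hη
        obtain ⟨j, rfl⟩ := mem_famMultiset.1 hz
        exact hne (hEC ▸ Set.mem_univ j : j ∈ flatOf K X η)
      have h1 := hf' _ (Or.inl hC)
      rw [hc, dirDerivEnd_smul_pow, LinearMap.smul_apply, smul_eq_zero] at h1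
      exact h1.resolve_left (pow_ne_zero _ hc0)
    rcases hk with rfl | rfl
    · exact (mem_powKer_neg_one_iff hX' S).2 hhyp
    · refine mem_powKer_zero_of hX' hhyp fun η _ hmiss => ?_
      rw [spanIn_famMultiset, ← h η] at hmiss
      have hflat := isFlat_flatOf X η
      by_cases hmax : IsMaximalMissingFlat K X J (flatOf K X η)
      · left
        have hEC := hE _ hflat
        refine ⟨E (flatOf K X η), fun z hz => ?_, ?_⟩
        · obtain ⟨j, rfl⟩ := mem_famMultiset.1 hz
          exact (Set.ext_iff.1 hEC j).symm
        · have h1 := hf' _ (Or.inr hmax)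
          rw [exponent, if_neg hmiss, ← numOff_famMultiset, add_zero, add_zero,
            Int.toNat_natCast] at h1
          exact h1
      · right
        rw [IsMaximalMissingFlat, Maximal] at hmax
        push Not at hmax
        obtain ⟨C', ⟨hC', hC'J⟩, hle, hnle⟩ := hmax ⟨hflat, hmiss⟩
        have hEC := hE _ hC'
        refine ⟨E C', fun z hz hz0 => ?_, ?_, ?_, ?_⟩
        · obtain ⟨j, rfl⟩ := mem_famMultiset.1 hz
          have : j ∈ flatOf K X (E C') := by rw [hEC]; exact hle hz0
          exact this
        · obtain ⟨j, hj, hj'⟩ := Set.not_subset.1 hnle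
          refine ⟨X j, mem_famMultiset.2 ⟨j, rfl⟩, hj', ?_⟩
          have : j ∈ flatOf K X (E C') := by rw [hEC]; exact hj
          exact this
        · intro h0
          rw [h0, flatOf_zero] at hEC
          exact hC'J (hEC ▸ huniv)
        · rw [spanIn_famMultiset, ← h, hEC]
          exact hC'J
  · rintro hf _ ⟨C, hC, rfl⟩
    have hflat : IsFlat K X C := hC.elim (fun h => h.1) fun h => h.1.1
    have hEC := hE C hflat
    have hE0 : E C ≠ 0 := by
      intro h0
      rw [h0, flatOf_zero] at hEC
      subst hEC
      rcases hC with hC | hC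
      · have := hC.2
        rw [rank, Set.image_univ, hX, finrank_top] at this
        omega
      · exact hC.1.2 huniv
    have h1 := hf (E C) hE0
    rw [← exponent_flatOf h, hEC] at h1
    exact (ι_pow_mem_annIdeal K).2 h1

theorem span_range_deletion_of_not_isColoop {X : ι → U}
    (hX : Submodule.span K (Set.range X) = ⊤) {i : ι} (hi : ¬ IsColoop K X i) :
    Submodule.span K (Set.range (deletion X i)) = ⊤ := by
  have himg : X '' {i}ᶜ = Set.range (deletion X i) := by
    ext z
    constructor
    · rintro ⟨j, hj, rfl⟩
      exact ⟨⟨j, hj⟩, rfl⟩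
    · rintro ⟨⟨j, hj⟩, rfl⟩
      exact ⟨j, hj, rfl⟩
  by_contra hne
  apply hi
  rw [IsColoop, rank, himg]
  have h1 := Submodule.finrank_lt hne
  have h2 : Submodule.span K (Set.range (deletion X i)) ⊔ Submodule.span K {X i} = ⊤ := by
    rw [← Submodule.span_union, eq_top_iff, ← hX]
    refine Submodule.span_mono ?_
    rintro _ ⟨j, rfl⟩
    by_cases hj : j = i
    · exact Or.inr (by rw [hj]; rfl)
    · exact Or.inl ⟨⟨j, hj⟩, rfl⟩
  have h3 := Submodule.finrank_add_le_finrank_add_finrank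
    (Submodule.span K (Set.range (deletion X i))) (Submodule.span K {X i})
  have h4 : finrank K (Submodule.span K {X i}) ≤ 1 := by
    simpa using finrank_span_le_card (R := K) ({X i} : Set U)
  rw [h2, finrank_top] at h3
  omega

end Closure

/-- Everything except surjectivity holds for all integers $k$ and all upper sets. -/
theorem isGradedShortExact_powKer [CharZero K] [FiniteDimensional K U] (k : ℤ)
    {S : Set (Submodule K U)} (hS : IsUpperSet S) {x : U} (hx : x ≠ 0) (X : Multiset U)
    (hsurj : ∀ h ∈ powKer K (powExp K k (quotUpper S x) (X.map (Submodule.span K {x}).mkQ)),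
      ∃ g ∈ powKer K (powExp K k S (x ::ₘ X)), symMap K (Submodule.span K {x}).mkQ g = h) :
    IsGradedShortExact K (LinearMap.mulLeft K (SymmetricAlgebra.ι K U x))
      (symMap K (Submodule.span K {x}).mkQ).toLinearMap
      (powKer K (powExp K k S X)) (powKer K (powExp K k S (x ::ₘ X)))
      (powKer K (powExp K k (quotUpper S x) (X.map (Submodule.span K {x}).mkQ))) where
  graded_left := isGraded_powKer K _
  graded_middle := isGraded_powKer K _
  graded_right := isGraded_powKer K _
  mapsTo_left _ hf := ι_mul_mem_powKer k hS x X hf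
  mapsTo_right _ hg := symMap_mem_powKer k S x X hg
  degree_left _ _ _ hf := ι_mul_mem_symDegree K x hf
  degree_right _ _ _ hg := symMap_mem_symDegree K _ hg
  injective _ _ h := (mul_eq_zero.1 h).resolve_left (ι_ne_zero hx)
  exact_middle g hg := by
    refine (symMap_mkQ_eq_zero_iff K x g).trans ⟨?_, ?_⟩
    · rintro ⟨f, rfl⟩
      exact ⟨f, mem_powKer_of_ι_mul_mem k hS hx X hg, rfl⟩
    · rintro ⟨f, -, hf⟩
      exact ⟨f, hf⟩
  surjective := hsurj

theorem exists_lift_of_upperSetOfFlats [CharZero K] [FiniteDimensional K U] [Finite ι] {X : ι → U}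
    (hX : Submodule.span K (Set.range X) = ⊤) {k : ℤ} (hk : -1 ≤ k) {J : Set (Set ι)}
    (hJ : IsUpperSetOfFlats K X J) {i : ι} (hi : ¬ IsColoop K X i)
    (hkJ : k = -1 → (∀ H, IsHyperplane K X H → H ∈ J) ∨ J = {Set.univ}) :
    ∀ h ∈ powKer K (powExp K k (quotUpper (upperOf K X J) (X i))
        ((famMultiset (deletion X i)).map (Submodule.span K {X i}).mkQ)),
      ∃ g ∈ powKer K (powExp K k (upperOf K X J) (X i ::ₘ famMultiset (deletion X i))),
        symMap K (Submodule.span K {X i}).mkQ g = h := by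
  intro h hh
  have hdel : spanAll K (famMultiset (deletion X i)) = ⊤ := by
    rw [spanAll_famMultiset, span_range_deletion_of_not_isColoop hX hi]
  have hall : spanAll K (X i ::ₘ famMultiset (deletion X i)) = ⊤ := by
    rw [spanAll_cons, hdel, top_sup_eq]
  have htop : IsUpperSet ({⊤} : Set (Submodule K U)) := fun a b hab ha => by
    rw [Set.mem_singleton_iff] at ha ⊢
    rw [ha] at hab
    exact top_le_iff.1 hab
  rcases hk.eq_or_lt with rfl | hk
  · rcases hkJ rfl with hH | rfl
    · have hS : ∀ η : Dual K U, η ≠ 0 →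
          spanIn K (X i ::ₘ famMultiset (deletion X i)) η = LinearMap.ker η →
          spanIn K (X i ::ₘ famMultiset (deletion X i)) η ∈ upperOf K X J := by
        intro η hη h1
        rw [← famMultiset_eq_cons, spanIn_famMultiset] at h1 ⊢
        rw [← describes_upperOf]
        exact hH _ (isHyperplane_flatOf hη h1)
      rw [powKer_neg_one_eq_of_hyperplanes ((spanAll_map_eq_top_iff _ _).2 hall)
        (spanIn_mem_quotUpper hS), ← quotUpper_singleton_top (X i)] at hh
      rw [powKer_neg_one_eq_of_hyperplanes hall hS]
      exact exists_lift_of_mem_powKer 0 htop (Set.mem_singleton _) _ _ hh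
    · have hS : upperOf K X {Set.univ} = {⊤} := by
        ext W
        simp only [upperOf, Set.mem_ofPred_eq, Set.mem_singleton_iff]
        constructor
        · intro h1
          rw [eq_top_iff, ← hX, Submodule.span_le]
          rintro _ ⟨j, rfl⟩
          exact (h1 ▸ Set.mem_univ j : j ∈ X ⁻¹' (W : Set U))
        · rintro rfl
          rfl
      rw [hS] at hh ⊢
      rw [quotUpper_singleton_top] at hh
      exact exists_lift_internal hdel hh
  · obtain ⟨n, rfl⟩ := Int.eq_ofNat_of_zero_le (by omega : 0 ≤ k)
    exact exists_lift_of_mem_powKer n (isUpperSet_upperOf hJ) (top_mem_upperOf hJ) _ _ hh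

end Families

end Zonotopal

end

/-! ### The proposition. -/

open Zonotopal in
theorem mainTheorem2 {K : Type*} [Field K] [CharZero K]
    {U : Type*} [AddCommGroup U] [Module K U] [FiniteDimensional K U]
    (hr : 1 ≤ Module.finrank K U)
    {ι : Type*} [Finite ι] (X : ι → U) (hX : Submodule.span K (Set.range X) = ⊤)
    (k : ℤ) (hk : -1 ≤ k)
    (J : Set (Set ι)) (hJ : IsUpperSetOfFlats K X J) (i : ι) :
    -- `x = X i` is neither a loop nor a coloop
    (X i ≠ 0 → ¬ IsColoop K X i →
      (k = -1 → (∀ H, IsHyperplane K X H → H ∈ J) ∨ J = {Set.univ}) →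
      IsGradedShortExact K
        (LinearMap.mulLeft K (SymmetricAlgebra.ι K U (X i)))
        (symMap K (Submodule.span K {X i}).mkQ).toLinearMap
        (ker K (hierIdeal K (deletion X i) k (delUpper K X J i)))
        (ker K (hierIdeal K X k J))
        (ker K (hierIdeal K (contraction K X i) k (contrUpper J i))) ∧
      (k = -1 ∨ k = 0 →
        ∀ E E' E'', IsNormalSelector K X E → IsNormalSelector K (deletion X i) E' →
          IsNormalSelector K (contraction K X i) E'' →
          IsGradedShortExact K
            (LinearMap.mulLeft K (SymmetricAlgebra.ι K U (X i)))
            (symMap K (Submodule.span K {X i}).mkQ).toLinearMap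
            (ker K (hierIdeal' K (deletion X i) k (delUpper K X J i) E'))
            (ker K (hierIdeal' K X k J E))
            (ker K (hierIdeal' K (contraction K X i) k (contrUpper J i) E'')))) ∧
    -- `x = X i` is a loop
    (X i = 0 →
      ker K (hierIdeal K (deletion X i) k (delUpper K X J i)) = ker K (hierIdeal K X k J) ∧
      (k = -1 ∨ k = 0 →
        ∀ E E', IsNormalSelector K X E → IsNormalSelector K (deletion X i) E' →
          ker K (hierIdeal' K (deletion X i) k (delUpper K X J i) E') =
            ker K (hierIdeal' K X k J E))) := by
  have hdelta := describes_deletion (K := K) X J i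
  have hcontr := describes_contraction (K := K) X J i
  have hJ' := describes_upperOf (K := K) X J
  have htop := top_mem_upperOf hJ
  refine ⟨fun hx hi hkJ => ?_, fun hx => ?_⟩
  · have hdel := span_range_deletion_of_not_isColoop hX hi
    have hall : Submodule.span K (Set.range (contraction K X i)) = ⊤ := by
      rw [← spanAll_famMultiset, famMultiset_contraction, spanAll_map_eq_top_iff,
        ← famMultiset_eq_cons, spanAll_famMultiset, hX]
    have key := isGradedShortExact_powKer k (isUpperSet_upperOf hJ) hx
      (famMultiset (deletion X i)) (exists_lift_of_upperSetOfFlats hX hk hJ hi hkJ)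
    rw [← famMultiset_eq_cons, ← famMultiset_contraction] at key
    refine ⟨?_, fun hk' E E' E'' hE hE' hE'' => ?_⟩
    · rw [ker_hierIdeal hdelta, ker_hierIdeal hJ', ker_hierIdeal hcontr]
      exact key
    · rw [ker_hierIdeal' hdel htop hdelta hk' hE', ker_hierIdeal' hX htop hJ' hk' hE,
        ker_hierIdeal' hall htop hcontr hk' hE'']
      exact key
  · have hcons := famMultiset_eq_cons X i
    rw [hx] at hcons
    -- A zero vector lies in every hyperplane and adds nothing to any span, so no exponent changes.
    have key := powExp_zero_cons k (upperOf K X J) (famMultiset (deletion X i))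
    rw [← hcons] at key
    refine ⟨?_, fun hk' E E' hE hE' => ?_⟩
    · rw [ker_hierIdeal hdelta, ker_hierIdeal hJ', key]
    · have hdel : Submodule.span K (Set.range (deletion X i)) = ⊤ := by
        rw [← hX, ← spanAll_famMultiset, ← spanAll_famMultiset, hcons, spanAll_cons,
          Submodule.span_zero_singleton, sup_bot_eq]
      rw [ker_hierIdeal' hdel htop hdelta hk' hE', ker_hierIdeal' hX htop hJ' hk' hE, key]
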